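/- Let $0<\alpha<1$, $\alpha_0>0$, $\beta\in\mathbb R$, $\varepsilon>0$, $\mathbb T=\mathbb R/2\pi\mathbb Z$. For $k\ge 1$ let $C^{k,\alpha}(\mathbb T)$ be the space of real $2\pi$-periodic $C^k$ functions with finite norm $$\|f\|_{C^{k,\alpha}}=\sum_{\ell=0}^{k}\sup_x|f^{(\ell)}(x)|+\sup_{x\neq y}\frac{|f^{(k)}(x)-f^{(k)}(y)|}{|x-y|^\alpha}.$$ Let $$X=\Big\{f\in C^{3,\alpha}(\mathbb T):\ f(\xi)=\sum_{k\ge1}f_k\cos(k\xi)\Big\},\qquad Y=\Big\{f\in C^{1,\alpha}(\mathbb T):\ f(\xi)=\sum_{k\ge1}f_k\sin(k\xi)\Big\},$$ with the norms of $C^{3,\alpha}$ and $C^{1,\alpha}$. Let $$\mathcal H[f](x)=\frac1{2\pi}\,\mathrm{p.v.}\!\int_{-\pi}^{\pi}\frac{f(y)}{\tan\left(\frac{x-y}{2}\right)}\,dy$$ be the periodic Hilbert transform (the principal value at the singularity $y\equiv x$ on $\mathbb T$), let $[\![\mathcal H,f]\!][g]=\mathcal H[fg]-f\,\mathcal H[g]$,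 and for $c\in\mathbb R$ let $$\begin{aligned}F[c,\varphi]={}&2c\varphi'+\Big(c\alpha_0+\frac{\alpha_0-\beta}{\varepsilon}\Big)\mathcal H[\varphi'']+\frac1\varepsilon\big(\varphi'+\mathcal H[\varphi]\big)+\mathcal H\big[(\mathcal H\varphi')^2\big]\\&-[\![\mathcal H,\varphi]\!][\mathcal H\varphi']-(\alpha_0-\beta)[\![\mathcal H,\varphi]\!][\mathcal H\varphi'''].\end{aligned}$$ **Proposition.** (1) $F$ is well defined: for all $\varphi,h\in C^{3,\alpha}(\mathbb T)$, all the principal values that occur in $F[c,\varphi]$, and in the formula for $\partial_\varphi F[c,\varphi]h$ below, exist at every point; if $\varphi\in C^{3,\alpha}(\mathbb T)$ is even, then $F[c,\varphi]$ is odd; and $F[c,\varphi]\in Y$ for all $c\in\mathbb R$ and $\varphi\in X$. (2) The map $F:\mathbb R\times X\to Y$ is of class $C^1$ (in the Fréchet sense). (3) For all $c\in\mathbb R$ and $\varphi,h\in X$, the Gateaux derivative of $F[c,\cdot]$ at $\varphi$ in the direction $h$ exists in $Y$, is a bounded linear function of $h\in X$, and equals $$\begin{aligned}\partial_\varphi F[c,\varphi]h={}&2ch'+\Big(c\alpha_0+\frac{\alpha_0-\beta}{\varepsilon}\Big)\mathcal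 H[h'']+\frac1\varepsilon\big(h'+\mathcal H[h]\big)+2\mathcal H\big[\mathcal H\varphi'\,\mathcal Hh'\big]-[\![\mathcal H,h]\!][\mathcal H\varphi']\\&-[\![\mathcal H,\varphi]\!][\mathcal Hh']-(\alpha_0-\beta)[\![\mathcal H,h]\!][\mathcal H\varphi''']-(\alpha_0-\beta)[\![\mathcal H,\varphi]\!][\mathcal Hh'''].\end{aligned}$$ There is a constant $C$, depending only on $\alpha,\alpha_0,\beta,\varepsilon$, such that for all $c\in\mathbb R$ and $\varphi_1,\varphi_2,h\in X$, $$\|\partial_\varphi F[c,\varphi_1]h-\partial_\varphi F[c,\varphi_2]h\|_{Y}\le C\,\|h\|_X\,\|\varphi_1-\varphi_2\|_X .$$ -/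

import Mathlib

namespace OddWaves

open Filter Topology MeasureTheory

/-! Hölder spaces on the torus `ℝ / 2πℤ`; functions on the torus are `2π`-periodic functions on
`ℝ`. -/

/-- The real functions of class `C^{k,a}` on the torus. -/
def holderSubmodule (k : ℕ) (a : ℝ) : Submodule ℝ (ℝ → ℝ) where
  carrier := {f | Function.Periodic f (2 * Real.pi) ∧ ContDiff ℝ k f ∧
    ∃ C : ℝ, ∀ x y : ℝ, |iteratedDeriv k f x - iteratedDeriv k f y| ≤ C * |x - y| ^ a}
  zero_mem' := by
    refine ⟨fun x => rfl, contDiff_const, 0, fun x y => ?_⟩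
    have h : iteratedDeriv k (0 : ℝ → ℝ) = fun _ => iteratedDeriv k (0 : ℝ → ℝ) 0 := by
      have h0 : (0 : ℝ → ℝ) = fun _ => (0 : ℝ) := rfl
      rw [h0]
      funext x
      simp
    rw [h]
    simp
  add_mem' := by
    rintro f g ⟨hfp, hf, C, hC⟩ ⟨hgp, hg, D, hD⟩
    refine ⟨hfp.add hgp, hf.add hg, C + D, fun x y => ?_⟩
    rw [iteratedDeriv_add hf.contDiffAt hg.contDiffAt,
      iteratedDeriv_add hf.contDiffAt hg.contDiffAt, add_mul, add_sub_add_comm]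
    exact (abs_add_le _ _).trans (add_le_add (hC x y) (hD x y))
  smul_mem' := by
    rintro c f ⟨hfp, hf, C, hC⟩
    refine ⟨hfp.smul c, hf.const_smul c, |c| * C, fun x y => ?_⟩
    rw [iteratedDeriv_const_smul hf.contDiffAt, iteratedDeriv_const_smul hf.contDiffAt,
      ← smul_sub, smul_eq_mul, abs_mul, mul_assoc]
    exact mul_le_mul_of_nonneg_left (hC x y) (abs_nonneg c)

/-- `C^{k,a}` of the torus, as a type that carries only the Hölder norm. -/
def Holder (k : ℕ) (a : ℝ) : Type := holderSubmodule k a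

noncomputable instance (k : ℕ) (a : ℝ) : AddCommGroup (Holder k a) :=
  inferInstanceAs (AddCommGroup (holderSubmodule k a))

noncomputable instance (k : ℕ) (a : ℝ) : Module ℝ (Holder k a) :=
  inferInstanceAs (Module ℝ (holderSubmodule k a))

instance (k : ℕ) (a : ℝ) : CoeFun (Holder k a) (fun _ => ℝ → ℝ) := ⟨fun f => f.1⟩

/-- The supremum of `|g|`, for bounded `g`. -/
noncomputable def supNorm {ι : Type} (g : ι → ℝ) : ℝ := ⨆ i, |g i|

/-- The difference quotient `(g x - g y) / |x - y| ^ a` (it is `0` on the diagonal). -/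
noncomputable def holderQuot (a : ℝ) (g : ℝ → ℝ) (p : ℝ × ℝ) : ℝ :=
  (g p.1 - g p.2) / |p.1 - p.2| ^ a

/-- The `C^{k,a}` norm: the suprema of all derivatives of order at most `k`, plus the Hölder
seminorm of the derivative of order `k`. -/
noncomputable instance (k : ℕ) (a : ℝ) : Norm (Holder k a) :=
  ⟨fun f => (∑ l ∈ Finset.range (k + 1), supNorm (iteratedDeriv l f)) +
    supNorm (holderQuot a (iteratedDeriv k f))⟩

/-- Boundedness of a real function. -/
def Bdd {ι : Type} (g : ι → ℝ) : Prop := ∃ C : ℝ, ∀ i, |g i| ≤ C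

theorem Bdd.bddAbove {ι : Type} {g : ι → ℝ} (hg : Bdd g) :
    BddAbove (Set.range fun i => |g i|) := by
  obtain ⟨C, hC⟩ := hg
  exact ⟨C, by rintro _ ⟨i, rfl⟩; exact hC i⟩

theorem supNorm_nonneg {ι : Type} (g : ι → ℝ) : 0 ≤ supNorm g :=
  Real.iSup_nonneg fun i => abs_nonneg (g i)

theorem le_supNorm {ι : Type} {g : ι → ℝ} (hg : Bdd g) (i : ι) : |g i| ≤ supNorm g :=
  le_ciSup hg.bddAbove i

theorem supNorm_add_le {ι : Type} [Nonempty ι] {g h : ι → ℝ} (hg : Bdd g) (hh : Bdd h) :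
    supNorm (g + h) ≤ supNorm g + supNorm h :=
  ciSup_le fun i => (abs_add_le _ _).trans (add_le_add (le_supNorm hg i) (le_supNorm hh i))

theorem supNorm_smul {ι : Type} (c : ℝ) (g : ι → ℝ) : supNorm (c • g) = |c| * supNorm g := by
  unfold supNorm
  rw [Real.mul_iSup_of_nonneg (abs_nonneg c)]
  simp [abs_mul]

theorem holderQuot_add (a : ℝ) (g h : ℝ → ℝ) :
    holderQuot a (g + h) = holderQuot a g + holderQuot a h := by
  funext p
  simp only [holderQuot, Pi.add_apply]
  ring

theorem holderQuot_smul (a c : ℝ) (g : ℝ → ℝ) :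
    holderQuot a (c • g) = c • holderQuot a g := by
  funext p
  simp only [holderQuot, Pi.smul_apply, smul_eq_mul]
  ring

namespace Holder

variable {k : ℕ} {a : ℝ}

theorem contDiff (f : Holder k a) : ContDiff ℝ k f := f.2.2.1

theorem periodic (f : Holder k a) : Function.Periodic f (2 * Real.pi) := f.2.1

theorem bdd_iteratedDeriv (f : Holder k a) {l : ℕ} (hl : l ≤ k) : Bdd (iteratedDeriv l f) := by
  have hc : Continuous (iteratedDeriv l f) :=
    f.contDiff.continuous_iteratedDeriv l (by exact_mod_cast hl)
  have hp : Function.Periodic (iteratedDeriv l f) (2 * Real.pi) := by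
    intro x
    have h : (fun z => (f : ℝ → ℝ) (z + 2 * Real.pi)) = f := funext f.periodic
    have h2 := congrFun (iteratedDeriv_comp_add_const l (f : ℝ → ℝ) (2 * Real.pi)) x
    rw [h] at h2
    exact h2.symm
  obtain ⟨C, hC⟩ := (isCompact_Icc (a := (0 : ℝ)) (b := 2 * Real.pi)).exists_bound_of_continuousOn
    hc.continuousOn
  refine ⟨C, fun x => ?_⟩
  obtain ⟨y, hy, hxy⟩ := hp.exists_mem_Ico₀ Real.two_pi_pos x
  rw [hxy]
  exact hC y ⟨hy.1, hy.2.le⟩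

theorem bdd_holderQuot (f : Holder k a) : Bdd (holderQuot a (iteratedDeriv k f)) := by
  obtain ⟨C, hC⟩ := f.2.2.2
  refine ⟨max C 0, fun p => ?_⟩
  have h0 : (0 : ℝ) ≤ |p.1 - p.2| ^ a := Real.rpow_nonneg (abs_nonneg _) a
  rw [holderQuot, abs_div, abs_of_nonneg h0]
  refine div_le_of_le_mul₀ h0 (le_max_right _ _) ((hC p.1 p.2).trans ?_)
  exact mul_le_mul_of_nonneg_right (le_max_left _ _) h0

theorem coe_add (f g : Holder k a) : ((f + g : Holder k a) : ℝ → ℝ) = f + g := rfl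

theorem coe_smul (c : ℝ) (f : Holder k a) : ((c • f : Holder k a) : ℝ → ℝ) = c • f.1 := rfl

theorem iteratedDeriv_add' (f g : Holder k a) {l : ℕ} (hl : l ≤ k) :
    iteratedDeriv l (f + g : Holder k a) = iteratedDeriv l f + iteratedDeriv l g := by
  have hl' : (l : WithTop ℕ∞) ≤ (k : WithTop ℕ∞) := by exact_mod_cast hl
  funext x
  exact iteratedDeriv_add (f.contDiff.of_le hl').contDiffAt (g.contDiff.of_le hl').contDiffAt

theorem iteratedDeriv_smul' (c : ℝ) (f : Holder k a) {l : ℕ} (hl : l ≤ k) :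
    iteratedDeriv l (c • f : Holder k a) = c • iteratedDeriv l f := by
  have hl' : (l : WithTop ℕ∞) ≤ (k : WithTop ℕ∞) := by exact_mod_cast hl
  funext x
  exact iteratedDeriv_const_smul (c := c) (f := (f : ℝ → ℝ)) (f.contDiff.of_le hl').contDiffAt

theorem norm_def (f : Holder k a) :
    ‖f‖ = (∑ l ∈ Finset.range (k + 1), supNorm (iteratedDeriv l f)) +
      supNorm (holderQuot a (iteratedDeriv k f)) := rfl

theorem core : NormedSpace.Core ℝ (Holder k a) where
  norm_nonneg f := add_nonneg (Finset.sum_nonneg fun _ _ => supNorm_nonneg _) (supNorm_nonneg _)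
  norm_smul c f := by
    rw [norm_def, norm_def, iteratedDeriv_smul' c f le_rfl, holderQuot_smul, supNorm_smul,
      Real.norm_eq_abs, mul_add, Finset.mul_sum]
    congr 1
    refine Finset.sum_congr rfl fun l hl => ?_
    rw [iteratedDeriv_smul' c f (by simpa [Nat.lt_succ_iff] using hl), supNorm_smul]
  norm_triangle f g := by
    rw [norm_def, norm_def, norm_def, add_add_add_comm, ← Finset.sum_add_distrib,
      iteratedDeriv_add' f g le_rfl, holderQuot_add]
    refine add_le_add (Finset.sum_le_sum fun l hl => ?_)
      (supNorm_add_le f.bdd_holderQuot g.bdd_holderQuot)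
    have hl' : l ≤ k := by simpa [Nat.lt_succ_iff] using hl
    rw [iteratedDeriv_add' f g hl']
    exact supNorm_add_le (f.bdd_iteratedDeriv hl') (g.bdd_iteratedDeriv hl')
  norm_eq_zero_iff f := by
    constructor
    · intro h
      have h1 : ∀ l ∈ Finset.range (k + 1), 0 ≤ supNorm (iteratedDeriv l f) :=
        fun l _ => supNorm_nonneg _
      have h2 : supNorm (iteratedDeriv 0 f) ≤ ‖f‖ :=
        (Finset.single_le_sum h1 (by simp)).trans
          (le_add_of_nonneg_right (supNorm_nonneg _))
      apply Subtype.ext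
      funext x
      have h3 := (le_supNorm (f.bdd_iteratedDeriv (Nat.zero_le k)) x).trans h2
      rw [h, iteratedDeriv_zero] at h3
      exact abs_nonpos_iff.1 h3
    · rintro rfl
      have h := iteratedDeriv_smul' (k := k) (a := a) 0 0 (l := k) le_rfl
      rw [norm_def, ← zero_smul ℝ (0 : Holder k a), h, holderQuot_smul, supNorm_smul]
      simp only [abs_zero, zero_mul, add_zero]
      refine Finset.sum_eq_zero fun l hl => ?_
      rw [iteratedDeriv_smul' 0 0 (by simpa [Nat.lt_succ_iff] using hl), supNorm_smul]
      simp

end Holder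

noncomputable instance (k : ℕ) (a : ℝ) : NormedAddCommGroup (Holder k a) :=
  NormedAddCommGroup.ofCore Holder.core

noncomputable instance (k : ℕ) (a : ℝ) : NormedSpace ℝ (Holder k a) :=
  NormedSpace.ofCore Holder.core

/-- `X`: the functions in `C^{3,a}` of the form `∑_{k ≥ 1} u k * cos (k ξ)`, with the
`C^{3,a}` norm. -/
def X (a : ℝ) : Submodule ℝ (Holder 3 a) where
  carrier := {f | ∃ u : ℕ → ℝ, ∀ x : ℝ,
    HasSum (fun k : ℕ => u (k + 1) * Real.cos ((k + 1 : ℕ) * x)) (f x)}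
  zero_mem' := by
    refine ⟨0, fun x => ?_⟩
    simp only [Pi.zero_apply, zero_mul]
    exact hasSum_zero
  add_mem' := by
    rintro f g ⟨u, hu⟩ ⟨v, hv⟩
    refine ⟨u + v, fun x => ?_⟩
    simp only [Pi.add_apply, add_mul]
    exact (hu x).add (hv x)
  smul_mem' := by
    rintro c f ⟨u, hu⟩
    refine ⟨c • u, fun x => ?_⟩
    simp only [Pi.smul_apply, smul_eq_mul, mul_assoc]
    exact (hu x).mul_left c

/-- `Y`: the functions in `C^{1,a}` of the form `∑_{k ≥ 1} u k * sin (k ξ)`, with the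
`C^{1,a}` norm. -/
def Y (a : ℝ) : Submodule ℝ (Holder 1 a) where
  carrier := {f | ∃ u : ℕ → ℝ, ∀ x : ℝ,
    HasSum (fun k : ℕ => u (k + 1) * Real.sin ((k + 1 : ℕ) * x)) (f x)}
  zero_mem' := by
    refine ⟨0, fun x => ?_⟩
    simp only [Pi.zero_apply, zero_mul]
    exact hasSum_zero
  add_mem' := by
    rintro f g ⟨u, hu⟩ ⟨v, hv⟩
    refine ⟨u + v, fun x => ?_⟩
    simp only [Pi.add_apply, add_mul]
    exact (hu x).add (hv x)
  smul_mem' := by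
    rintro c f ⟨u, hu⟩
    refine ⟨c • u, fun x => ?_⟩
    simp only [Pi.smul_apply, smul_eq_mul, mul_assoc]
    exact (hu x).mul_left c

instance (a : ℝ) : CoeFun (X a) (fun _ => ℝ → ℝ) := ⟨fun f => f.1.1⟩

instance (a : ℝ) : CoeFun (Y a) (fun _ => ℝ → ℝ) := ⟨fun f => f.1.1⟩

/-! The periodic Hilbert transform. The integral over the torus is taken over the period
`[x - π, x + π]` centred at the singularity `y = x`, and the principal value removes
`|y - x| < δ`. -/

/-- The integrand `f y / tan ((x - y) / 2)`. -/
noncomputable def hilbertIntegrand (f : ℝ → ℝ) (x y : ℝ) : ℝ := f y / Real.tan ((x - y) / 2)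

/-- The truncated Hilbert transform. -/
noncomputable def hilbertTrunc (f : ℝ → ℝ) (x δ : ℝ) : ℝ :=
  1 / (2 * Real.pi) * ((∫ y in (x - Real.pi)..(x - δ), hilbertIntegrand f x y) +
    ∫ y in (x + δ)..(x + Real.pi), hilbertIntegrand f x y)

/-- The Hilbert transform `H f x = (2π)⁻¹ p.v. ∫ f y / tan ((x - y) / 2) dy`. -/
noncomputable def hilbert (f : ℝ → ℝ) (x : ℝ) : ℝ := limUnder (𝓝[>] 0) (hilbertTrunc f x)

/-- The principal value that defines `hilbert f x` exists at every point `x`. -/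
def HilbertExists (f : ℝ → ℝ) : Prop :=
  ∀ x : ℝ,
    (∀ δ ∈ Set.Ioo 0 Real.pi,
      IntervalIntegrable (hilbertIntegrand f x) volume (x - Real.pi) (x - δ) ∧
      IntervalIntegrable (hilbertIntegrand f x) volume (x + δ) (x + Real.pi)) ∧
    ∃ v : ℝ, Tendsto (hilbertTrunc f x) (𝓝[>] 0) (𝓝 v)

/-- The commutator `⟦T, f⟧ g = T (f g) - f T g`. -/
def commutator (T : (ℝ → ℝ) → ℝ → ℝ) (f g : ℝ → ℝ) : ℝ → ℝ := T (f * g) - f * T g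

/-- The traveling-wave operator `F[c, φ]`. -/
noncomputable def F (α₀ β ε c : ℝ) (φ : ℝ → ℝ) (ξ : ℝ) : ℝ :=
  2 * c * deriv φ ξ + (c * α₀ + (α₀ - β) / ε) * hilbert (iteratedDeriv 2 φ) ξ
    + 1 / ε * (deriv φ ξ + hilbert φ ξ)
    + hilbert (hilbert (deriv φ) ^ 2) ξ
    - commutator hilbert φ (hilbert (deriv φ)) ξ
    - (α₀ - β) * commutator hilbert φ (hilbert (iteratedDeriv 3 φ)) ξ

/-- The formula for the Gateaux derivative `∂_φ F[c, φ] h`. -/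
noncomputable def dF (α₀ β ε c : ℝ) (φ h : ℝ → ℝ) (ξ : ℝ) : ℝ :=
  2 * c * deriv h ξ + (c * α₀ + (α₀ - β) / ε) * hilbert (iteratedDeriv 2 h) ξ
    + 1 / ε * (deriv h ξ + hilbert h ξ)
    + 2 * hilbert (hilbert (deriv φ) * hilbert (deriv h)) ξ
    - commutator hilbert h (hilbert (deriv φ)) ξ
    - commutator hilbert φ (hilbert (deriv h)) ξ
    - (α₀ - β) * commutator hilbert h (hilbert (iteratedDeriv 3 φ)) ξ
    - (α₀ - β) * commutator hilbert φ (hilbert (iteratedDeriv 3 h)) ξ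

end OddWaves

namespace OddWaves

open Filter Topology MeasureTheory Set
open scoped Real

/-! `F` is affine in `c` and quadratic in φ: F[c, φ] = c V φ + L φ + Q(φ, φ), with V and L linear
and Q bilinear (`F_eq`). Once V, L and Q are bounded from C^{3,a} to C^{1,a}, everything
differential is formal: the map is smooth, its derivative in φ is h ↦ c V h + L h + Q(φ, h) + Q(h,
φ), and the difference of two derivatives involves Q alone, which gives the Lipschitz constant 2‖Q‖,
independent of `c`. The content is therefore in the bounds.

For Hölder `f`, oddness of the cotangent turns the principal value into an absolutely convergent
integral of (f (x - t) - f (x + t)) cot (t / 2) over (0, π). Hence all principal values exist, H can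
be differentiated under the integral sign, and H is bounded on C^{0,a} (Privalov,
`HolderBound.hilbert`) and on C^{1,a} (`HolderBound₁.hilbert`). Since C^{1,a} is an algebra, this
controls every term but the last.

The last term is the commutator of H and φ applied to H φ''', which is only C^{0,a}. But H φ''' is
the derivative of G = H φ'', which is C^{1,a}. Integration by parts (`commutator_hilbert_eq`) moves
the derivative from G to the kernel (φ y - φ x) cot ((x - y) / 2). The differentiated kernel is O(|x
- y|^(a - 1)) by Taylor expansion, so the commutator is as regular as G
(`holderBound₁_commIntegral`).

Finally, H exchanges even and odd functions, so `F` sends even functions to odd ones, and an odd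
periodic C¹ function is the sum of its sine series (`exists_hasSum_sin_of_odd`); this places the
values in `Y`. -/

/-- `f` is bounded by `C` and Hölder continuous of exponent `a` with constant `C`. -/
structure HolderBound (a : ℝ) (f : ℝ → ℝ) (C : ℝ) : Prop where
  bdd : ∀ x, |f x| ≤ C
  holder : ∀ x y, |f x - f y| ≤ C * |x - y| ^ a

/-- `f` is bounded by `C`, and its derivative `f'` satisfies `HolderBound a f' C`. -/
structure HolderBound₁ (a : ℝ) (f f' : ℝ → ℝ) (C : ℝ) : Prop where
  hasDerivAt : ∀ x, HasDerivAt f (f' x) x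
  bdd : ∀ x, |f x| ≤ C
  bound : HolderBound a f' C

/-! ### Functions with explicit Hölder bounds -/

theorem abs_sub_le_of_hasDerivAt {f f' : ℝ → ℝ} {C : ℝ} (hf : ∀ x, HasDerivAt f (f' x) x)
    (hC : ∀ x, |f' x| ≤ C) (x y : ℝ) : |f x - f y| ≤ C * |x - y| :=
  convex_univ.norm_image_sub_le_of_norm_hasDerivWithin_le
    (fun z _ => (hf z).hasDerivWithinAt) (fun z _ => hC z) (mem_univ y) (mem_univ x)

namespace HolderBound

variable {a C D : ℝ} {f g : ℝ → ℝ}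

theorem nonneg (hf : HolderBound a f C) : 0 ≤ C := (abs_nonneg _).trans (hf.bdd 0)

theorem mono (hf : HolderBound a f C) (h : C ≤ D) : HolderBound a f D :=
  ⟨fun x => (hf.bdd x).trans h, fun x y => (hf.holder x y).trans
    (mul_le_mul_of_nonneg_right h (Real.rpow_nonneg (abs_nonneg _) _))⟩

/-- A bound on short distances suffices, because the function is bounded. -/
theorem of_le_one (ha : 0 < a) (hb : ∀ x, |f x| ≤ C)
    (hh : ∀ x h, 0 < h → h ≤ 1 → |f (x + h) - f x| ≤ 2 * C * h ^ a) :
    HolderBound a f (2 * C) := by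
  have hC : 0 ≤ C := (abs_nonneg _).trans (hb 0)
  refine ⟨fun x => (hb x).trans (by linarith), ?_⟩
  have key : ∀ x y, x < y → |f y - f x| ≤ 2 * C * |y - x| ^ a := by
    intro x y hxy
    rw [abs_of_pos (sub_pos.2 hxy)]
    rcases le_or_gt (y - x) 1 with h1 | h1
    · simpa using hh x (y - x) (sub_pos.2 hxy) h1
    · have h2 : 1 ≤ (y - x) ^ a := Real.one_le_rpow h1.le ha.le
      have h3 := abs_sub (f y) (f x)
      nlinarith [hb x, hb y]
  intro x y
  rcases lt_trichotomy x y with h | rfl | h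
  · rw [abs_sub_comm, abs_sub_comm x]; exact key x y h
  · simp [Real.zero_rpow ha.ne']
  · exact key y x h

theorem of_hasDerivAt (ha : 0 < a) (ha1 : a < 1) {f' : ℝ → ℝ} (hf : ∀ x, HasDerivAt f (f' x) x)
    (hb : ∀ x, |f x| ≤ C) (hb' : ∀ x, |f' x| ≤ C) : HolderBound a f (2 * C) := by
  have hC : 0 ≤ C := (abs_nonneg _).trans (hb 0)
  refine of_le_one ha hb fun x h h0 h1 => ?_
  have h2 := abs_sub_le_of_hasDerivAt hf hb' (x + h) x
  rw [add_sub_cancel_left, abs_of_pos h0] at h2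
  have h3 : h ≤ h ^ a := by
    simpa using Real.rpow_le_rpow_of_exponent_ge h0 h1 ha1.le
  nlinarith

theorem continuous (ha : 0 < a) (hf : HolderBound a f C) : Continuous f := by
  rw [continuous_iff_continuousAt]
  intro x
  rw [ContinuousAt, tendsto_iff_norm_sub_tendsto_zero]
  have h : Tendsto (fun y : ℝ => C * |y - x| ^ a) (𝓝 x) (𝓝 0) := by
    have h1 : Continuous fun y : ℝ => C * |y - x| ^ a :=
      continuous_const.mul ((by fun_prop : Continuous fun y : ℝ => |y - x|).rpow_const
        fun _ => Or.inr ha.le)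
    simpa [Real.zero_rpow ha.ne'] using h1.tendsto x
  exact squeeze_zero (fun _ => norm_nonneg _) (fun y => hf.holder y x) h

theorem mul (hf : HolderBound a f C) (hg : HolderBound a g D) :
    HolderBound a (f * g) (2 * (C * D)) := by
  have hC := hf.nonneg
  have hD := hg.nonneg
  refine ⟨fun x => ?_, fun x y => ?_⟩
  · rw [Pi.mul_apply, abs_mul]
    nlinarith [mul_le_mul (hf.bdd x) (hg.bdd x) (abs_nonneg _) hC, mul_nonneg hC hD]
  · have h : (f * g) x - (f * g) y = (f x - f y) * g x + f y * (g x - g y) := by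
      simp only [Pi.mul_apply]; ring
    rw [h]
    refine (abs_add_le _ _).trans ?_
    rw [abs_mul, abs_mul]
    have h1 := mul_le_mul (hf.holder x y) (hg.bdd x) (abs_nonneg _)
      ((abs_nonneg _).trans (hf.holder x y))
    have h2 := mul_le_mul (hf.bdd y) (hg.holder x y) (abs_nonneg _) hC
    linarith

theorem add (hf : HolderBound a f C) (hg : HolderBound a g D) :
    HolderBound a (f + g) (C + D) := by
  refine ⟨fun x => (abs_add_le _ _).trans (add_le_add (hf.bdd x) (hg.bdd x)), fun x y => ?_⟩
  rw [Pi.add_apply, Pi.add_apply, add_sub_add_comm, add_mul]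
  exact (abs_add_le _ _).trans (add_le_add (hf.holder x y) (hg.holder x y))

theorem smul (c : ℝ) (hf : HolderBound a f C) : HolderBound a (c • f) (|c| * C) := by
  refine ⟨fun x => ?_, fun x y => ?_⟩
  · rw [Pi.smul_apply, smul_eq_mul, abs_mul]
    exact mul_le_mul_of_nonneg_left (hf.bdd x) (abs_nonneg c)
  · rw [Pi.smul_apply, Pi.smul_apply, ← smul_sub, smul_eq_mul, abs_mul, mul_assoc]
    exact mul_le_mul_of_nonneg_left (hf.holder x y) (abs_nonneg c)

/-- The increment of a translate of `f`. -/
theorem abs_translate_sub_le (hf : HolderBound a f C) {h : ℝ} (h0 : 0 < h) (x : ℝ) :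
    |f (x + h) - f x| ≤ C * h ^ a := by
  simpa [abs_of_pos h0] using hf.holder (x + h) x

end HolderBound

namespace HolderBound₁

variable {a C D : ℝ} {f f' g g' : ℝ → ℝ}

theorem nonneg (hf : HolderBound₁ a f f' C) : 0 ≤ C := hf.bound.nonneg

theorem holderBound (ha : 0 < a) (ha1 : a < 1) (hf : HolderBound₁ a f f' C) :
    HolderBound a f (2 * C) :=
  .of_hasDerivAt ha ha1 hf.hasDerivAt hf.bdd hf.bound.bdd

theorem continuous (hf : HolderBound₁ a f f' C) : Continuous f :=
  continuous_iff_continuousAt.2 fun x => (hf.hasDerivAt x).continuousAt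

theorem mul (ha : 0 < a) (ha1 : a < 1) (hf : HolderBound₁ a f f' C)
    (hg : HolderBound₁ a g g' D) :
    HolderBound₁ a (f * g) (f' * g + f * g') (8 * (C * D)) := by
  refine ⟨fun x => (hf.hasDerivAt x).mul (hg.hasDerivAt x), fun x => ?_, ?_⟩
  · rw [Pi.mul_apply, abs_mul]
    nlinarith [mul_le_mul (hf.bdd x) (hg.bdd x) (abs_nonneg _) hf.nonneg,
      mul_nonneg hf.nonneg hg.nonneg]
  · exact ((hf.bound.mul (hg.holderBound ha ha1)).add
      ((hf.holderBound ha ha1).mul hg.bound)).mono (by linarith)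

end HolderBound₁

/-! Kernels -/

/-- The kernel `cot (t / 2)`. -/
noncomputable def halfCot (t : ℝ) : ℝ := Real.cos (t / 2) / Real.sin (t / 2)

/-- The kernel `1 / (2 sin² (t / 2))`. -/
noncomputable def halfCsc (t : ℝ) : ℝ := 1 / (2 * Real.sin (t / 2) ^ 2)

theorem sin_half_pos {t : ℝ} (ht : t ∈ Ioc 0 π) : 0 < Real.sin (t / 2) :=
  Real.sin_pos_of_pos_of_lt_pi (by linarith [ht.1]) (by linarith [ht.1, ht.2, Real.pi_pos])

/-- Jordan's inequality, from which the size of both kernels near 0 follows. -/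
theorem div_pi_le_sin_half {t : ℝ} (ht : t ∈ Ioc 0 π) : t / π ≤ Real.sin (t / 2) := by
  have := Real.mul_le_sin (x := t / 2) (by linarith [ht.1]) (by linarith [ht.2])
  calc t / π = 2 / π * (t / 2) := by ring
    _ ≤ _ := this

theorem halfCot_neg (t : ℝ) : halfCot (-t) = -halfCot t := by
  simp [halfCot, neg_div, div_neg]

theorem halfCsc_neg (t : ℝ) : halfCsc (-t) = halfCsc t := by
  simp [halfCsc, neg_div]

theorem halfCot_pi : halfCot π = 0 := by simp [halfCot]

theorem abs_halfCot_le {t : ℝ} (ht : t ∈ Ioc 0 π) : |halfCot t| ≤ π / t := by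
  have h0 := sin_half_pos ht
  rw [halfCot, abs_div, abs_of_pos h0, div_le_div_iff₀ h0 ht.1]
  have h1 := div_pi_le_sin_half ht
  rw [div_le_iff₀ Real.pi_pos] at h1
  nlinarith [Real.abs_cos_le_one (t / 2), abs_nonneg (Real.cos (t / 2)), ht.1]

theorem abs_halfCsc_le {t : ℝ} (ht : t ∈ Ioc 0 π) : |halfCsc t| ≤ π ^ 2 / (2 * t ^ 2) := by
  have h0 := sin_half_pos ht
  have h2 : 0 < 2 * t ^ 2 := by have := ht.1; positivity
  rw [halfCsc, abs_of_pos (by positivity), div_le_div_iff₀ (by positivity) h2]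
  have h1 := div_pi_le_sin_half ht
  rw [div_le_iff₀ Real.pi_pos] at h1
  have h3 := pow_le_pow_left₀ ht.1.le h1 2
  nlinarith

theorem hasDerivAt_halfCot {t : ℝ} (ht : t ∈ Ioc 0 π) : HasDerivAt halfCot (-halfCsc t) t := by
  have h0 := (sin_half_pos ht).ne'
  have h1 : HasDerivAt (fun s : ℝ => s / 2) (1 / 2) t := (hasDerivAt_id t).div_const 2
  have h := (h1.cos).div (h1.sin) h0
  refine h.congr_deriv ?_
  rw [halfCsc]
  field_simp
  nlinarith [Real.sin_sq_add_cos_sq (t / 2)]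

theorem continuousOn_halfCot : ContinuousOn halfCot (Ioc 0 π) := fun _ ht =>
  (hasDerivAt_halfCot ht).continuousAt.continuousWithinAt

theorem continuousOn_halfCsc : ContinuousOn halfCsc (Ioc 0 π) := by
  unfold halfCsc
  refine ContinuousOn.div (by fun_prop) (by fun_prop) fun t ht => ?_
  have := sin_half_pos ht
  positivity

theorem halfCot_eq {t : ℝ} (ht : t ∈ Ioc 0 π) : halfCot t = Real.sin t * halfCsc t := by
  have h0 := (sin_half_pos ht).ne'
  have h1 : Real.sin t = 2 * Real.sin (t / 2) * Real.cos (t / 2) := by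
    rw [← Real.sin_two_mul]; ring_nf
  rw [halfCot, halfCsc, h1]
  field_simp

theorem abs_sin_sub_self_le {t : ℝ} (ht : 0 < t) : |Real.sin t - t| ≤ t ^ 2 := by
  have h1 := Real.sin_lt ht
  rw [abs_of_nonpos (by linarith)]
  -- The cubic lower bound for the sine suffices up to t = 6; beyond, -1 ≤ sin t is enough.
  rcases le_or_gt t 6 with h | h
  · nlinarith [Real.sin_gt_sub_cube ht, mul_nonneg (sq_nonneg t) (sub_nonneg.2 h)]
  · nlinarith [Real.neg_one_le_sin t]

/-! Integrals over `(0, π)` with an integrable power singularity at `0` -/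

/-- `u` is continuous on `(0, π]` and `O(t ^ (a - 1))` with constant `C`. -/
structure Singular (a C : ℝ) (u : ℝ → ℝ) : Prop where
  continuousOn : ContinuousOn u (Ioc 0 π)
  bound : ∀ t ∈ Ioc 0 π, |u t| ≤ C * t ^ (a - 1)

theorem intervalIntegrable_rpow_sub_one {a : ℝ} (ha : 0 < a) (C r s : ℝ) :
    IntervalIntegrable (fun t : ℝ => C * t ^ (a - 1)) volume r s :=
  (intervalIntegral.intervalIntegrable_rpow' (by linarith)).const_mul C

theorem integral_rpow_sub_one {a : ℝ} (ha : 0 < a) (C r : ℝ) :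
    ∫ t in (0 : ℝ)..r, C * t ^ (a - 1) = C * (r ^ a / a) := by
  rw [intervalIntegral.integral_const_mul, integral_rpow (Or.inl (by linarith)),
    sub_add_cancel, Real.zero_rpow ha.ne', sub_zero]

namespace Singular

variable {a C D : ℝ} {u v : ℝ → ℝ}

theorem aestronglyMeasurable (hu : Singular a C u) {r s : ℝ} (hr : 0 ≤ r) (hs : s ≤ π) :
    AEStronglyMeasurable u (volume.restrict (Ioc r s)) :=
  (hu.continuousOn.mono (Ioc_subset_Ioc hr hs)).aestronglyMeasurable measurableSet_Ioc

theorem intervalIntegrable (ha : 0 < a) (hu : Singular a C u) {r s : ℝ} (hr : 0 ≤ r)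
    (hrs : r ≤ s) (hs : s ≤ π) : IntervalIntegrable u volume r s := by
  refine (intervalIntegrable_rpow_sub_one ha C r s).mono_fun' ?_ ?_
  · rw [uIoc_of_le hrs]; exact hu.aestronglyMeasurable hr hs
  · rw [uIoc_of_le hrs]
    exact (ae_restrict_mem measurableSet_Ioc).mono fun t ht =>
      hu.bound t (Ioc_subset_Ioc hr hs ht)

theorem abs_integral_le (ha : 0 < a) (hu : Singular a C u) {r : ℝ} (hr : 0 ≤ r) (hr' : r ≤ π) :
    |∫ t in (0 : ℝ)..r, u t| ≤ C * (r ^ a / a) := by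
  rw [← integral_rpow_sub_one ha C r, ← Real.norm_eq_abs]
  refine intervalIntegral.norm_integral_le_of_norm_le hr ?_
    (intervalIntegrable_rpow_sub_one ha C 0 r)
  exact ae_of_all _ fun t ht => hu.bound t (Ioc_subset_Ioc le_rfl hr' ht)

/-- Removing (0, δ) changes the integral by O(δ^a). This is what replaces principal values by
convergent integrals. -/
theorem tendsto_integral (ha : 0 < a) (hu : Singular a C u) :
    Tendsto (fun δ => ∫ t in δ..π, u t) (𝓝[>] 0) (𝓝 (∫ t in (0 : ℝ)..π, u t)) := by
  have h1 : ∀ᶠ δ in 𝓝[>] (0 : ℝ),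
      |(∫ t in δ..π, u t) - ∫ t in (0 : ℝ)..π, u t| ≤ C * (δ ^ a / a) := by
    filter_upwards [Ioo_mem_nhdsGT Real.pi_pos] with δ hδ
    rw [← intervalIntegral.integral_add_adjacent_intervals
      (hu.intervalIntegrable ha le_rfl hδ.1.le hδ.2.le)
      (hu.intervalIntegrable ha hδ.1.le hδ.2.le le_rfl), abs_sub_comm, add_sub_cancel_right]
    exact hu.abs_integral_le ha hδ.1.le hδ.2.le
  have h2 : Tendsto (fun δ : ℝ => C * (δ ^ a / a)) (𝓝[>] 0) (𝓝 0) := by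
    have h3 : Continuous fun δ : ℝ => C * (δ ^ a / a) :=
      continuous_const.mul ((continuous_id.rpow_const fun _ => Or.inr ha.le).div_const a)
    have h4 := h3.tendsto 0
    rw [Real.zero_rpow ha.ne', zero_div, mul_zero] at h4
    exact h4.mono_left nhdsWithin_le_nhds
  rw [tendsto_iff_norm_sub_tendsto_zero]
  exact squeeze_zero' (Eventually.of_forall fun _ => norm_nonneg _) h1 h2

theorem add (hu : Singular a C u) (hv : Singular a D v) :
    Singular a (C + D) (fun t => u t + v t) :=
  ⟨hu.continuousOn.add hv.continuousOn, fun t ht => by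
    rw [add_mul]; exact (abs_add_le _ _).trans (add_le_add (hu.bound t ht) (hv.bound t ht))⟩

/-- Differentiation under the integral sign. -/
theorem hasDerivAt_integral (ha : 0 < a) {w w' : ℝ → ℝ → ℝ} (hw : ∀ x, Singular a C (w x))
    (hw' : ∀ x, Singular a D (w' x))
    (hd : ∀ x, ∀ t ∈ Ioc 0 π, HasDerivAt (fun z => w z t) (w' x t) x) (x : ℝ) :
    HasDerivAt (fun z => ∫ t in (0 : ℝ)..π, w z t) (∫ t in (0 : ℝ)..π, w' x t) x := by
  have hI : uIoc (0 : ℝ) π = Ioc 0 π := uIoc_of_le Real.pi_pos.le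
  refine (intervalIntegral.hasDerivAt_integral_of_dominated_loc_of_deriv_le
    (bound := fun t => D * t ^ (a - 1)) (F' := w') univ_mem (Eventually.of_forall fun z => ?_)
    ((hw x).intervalIntegrable ha le_rfl Real.pi_pos.le le_rfl) ?_
    (ae_of_all _ fun t ht z _ => ?_) (intervalIntegrable_rpow_sub_one ha D 0 π)
    (ae_of_all _ fun t ht z _ => ?_)).2
  · rw [hI]; exact (hw z).aestronglyMeasurable le_rfl le_rfl
  · rw [hI]; exact (hw' x).aestronglyMeasurable le_rfl le_rfl
  · rw [hI] at ht; exact (hw' z).bound t ht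
  · rw [hI] at ht; exact hd z t ht

end Singular

/-! The Hilbert transform on Hölder functions -/

/-- The symmetrized integrand of the Hilbert transform. -/
noncomputable def symmIntegrand (f : ℝ → ℝ) (x t : ℝ) : ℝ := (f (x - t) - f (x + t)) * halfCot t

theorem div_tan_half (c t : ℝ) : c / Real.tan (t / 2) = c * halfCot t := by
  rw [halfCot, Real.tan_eq_sin_div_cos, div_div_eq_mul_div, mul_div_assoc]

theorem hilbertIntegrand_sub (f : ℝ → ℝ) (x t : ℝ) :
    hilbertIntegrand f x (x - t) = f (x - t) * halfCot t := by
  rw [hilbertIntegrand, sub_sub_cancel, div_tan_half]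

theorem hilbertIntegrand_add (f : ℝ → ℝ) (x t : ℝ) :
    hilbertIntegrand f x (x + t) = -(f (x + t) * halfCot t) := by
  rw [hilbertIntegrand, sub_add_cancel_left, div_tan_half, halfCot_neg, mul_neg]

theorem intervalIntegrable_mul_halfCot {g : ℝ → ℝ} (hg : Continuous g) {δ : ℝ}
    (hδ : δ ∈ Ioo 0 π) : IntervalIntegrable (fun t => g t * halfCot t) volume δ π := by
  refine ContinuousOn.intervalIntegrable ?_
  rw [uIcc_of_le hδ.2.le]
  exact hg.continuousOn.mul (continuousOn_halfCot.mono fun t ht => ⟨hδ.1.trans_le ht.1, ht.2⟩)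

theorem intervalIntegrable_hilbertIntegrand {f : ℝ → ℝ} (hf : Continuous f) (x : ℝ) {δ : ℝ}
    (hδ : δ ∈ Ioo 0 π) :
    IntervalIntegrable (hilbertIntegrand f x) volume (x - π) (x - δ) ∧
      IntervalIntegrable (hilbertIntegrand f x) volume (x + δ) (x + π) := by
  constructor
  · have h := (intervalIntegrable_mul_halfCot (g := fun t => f (x - t))
      (by fun_prop) hδ).comp_sub_left x
    refine (h.congr fun y _ => ?_).symm
    have := hilbertIntegrand_sub f x (x - y)
    simp only [sub_sub_cancel] at this ⊢
    exact this.symm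
  · have h := ((intervalIntegrable_mul_halfCot (g := fun t => f (x + t))
      (by fun_prop) hδ).comp_sub_right x).neg
    have h' : IntervalIntegrable (hilbertIntegrand f x) volume (δ + x) (π + x) := by
      refine h.congr fun y _ => ?_
      have := hilbertIntegrand_add f x (y - x)
      simp only [add_sub_cancel] at this
      simp [this]
    rwa [add_comm δ, add_comm π] at h'

/-- The kernel is odd about the singularity, so the substitutions y = x - t and y = x + t fold the
two halves of the integral onto (δ, π) with opposite signs. -/
theorem hilbertTrunc_eq {f : ℝ → ℝ} (hf : Continuous f) (x : ℝ) {δ : ℝ} (hδ : δ ∈ Ioo 0 π) :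
    hilbertTrunc f x δ = 1 / (2 * π) * ∫ t in δ..π, symmIntegrand f x t := by
  have h1 := intervalIntegral.integral_comp_sub_left (hilbertIntegrand f x) x (a := δ) (b := π)
  have h2 := intervalIntegral.integral_comp_add_left (hilbertIntegrand f x) x (a := δ) (b := π)
  rw [hilbertTrunc, ← h1, ← h2]
  congr 1
  simp only [hilbertIntegrand_sub, hilbertIntegrand_add]
  rw [intervalIntegral.integral_neg, ← sub_eq_add_neg, ← intervalIntegral.integral_sub
    (intervalIntegrable_mul_halfCot (by fun_prop) hδ)
    (intervalIntegrable_mul_halfCot (by fun_prop) hδ)]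
  exact intervalIntegral.integral_congr fun t _ => (sub_mul _ _ _).symm

namespace HolderBound

variable {a C D : ℝ} {f g : ℝ → ℝ}

theorem continuousOn_symmIntegrand (ha : 0 < a) (hf : HolderBound a f C) (x : ℝ) :
    ContinuousOn (symmIntegrand f x) (Ioc 0 π) := by
  have := hf.continuous ha
  exact ContinuousOn.mul (by fun_prop) continuousOn_halfCot

/-- The increment of `f` is O(t^a) and the cotangent is at most π / t; the product has an integrable
singularity because a > 0. -/
theorem singular_symmIntegrand (ha : 0 < a) (ha1 : a < 1) (hf : HolderBound a f C) (x : ℝ) :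
    Singular a (2 * π * C) (symmIntegrand f x) := by
  refine ⟨hf.continuousOn_symmIntegrand ha x, fun t ht => ?_⟩
  have h0 := ht.1
  have h1 := hf.holder (x - t) (x + t)
  have h2 : |x - t - (x + t)| = 2 * t := by
    rw [show x - t - (x + t) = -(2 * t) by ring, abs_neg, abs_of_pos (by linarith)]
  have h3 : (2 * t) ^ a ≤ 2 * t ^ a := by
    rw [Real.mul_rpow (by norm_num) h0.le]
    refine mul_le_mul_of_nonneg_right ?_ (Real.rpow_nonneg h0.le _)
    simpa using Real.rpow_le_rpow_of_exponent_le (x := 2) (by norm_num) ha1.le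
  rw [h2] at h1
  have hC := hf.nonneg
  rw [symmIntegrand, abs_mul, Real.rpow_sub_one h0.ne']
  calc |f (x - t) - f (x + t)| * |halfCot t| ≤ (C * (2 * t ^ a)) * (π / t) := by
        gcongr
        · exact h1.trans (by gcongr)
        · exact abs_halfCot_le ht
    _ = _ := by ring

theorem tendsto_hilbertTrunc_integral (ha : 0 < a) (ha1 : a < 1) (hf : HolderBound a f C)
    (x : ℝ) : Tendsto (hilbertTrunc f x) (𝓝[>] 0)
      (𝓝 (1 / (2 * π) * ∫ t in (0 : ℝ)..π, symmIntegrand f x t)) := by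
  refine (((hf.singular_symmIntegrand ha ha1 x).tendsto_integral ha).const_mul _).congr' ?_
  filter_upwards [Ioo_mem_nhdsGT Real.pi_pos] with δ hδ
  exact (hilbertTrunc_eq (hf.continuous ha) x hδ).symm

theorem hilbertExists (ha : 0 < a) (ha1 : a < 1) (hf : HolderBound a f C) : HilbertExists f :=
  fun x => ⟨fun _ hδ => intervalIntegrable_hilbertIntegrand (hf.continuous ha) x hδ, _,
    hf.tendsto_hilbertTrunc_integral ha ha1 x⟩

theorem hilbert_eq (ha : 0 < a) (ha1 : a < 1) (hf : HolderBound a f C) (x : ℝ) :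
    hilbert f x = 1 / (2 * π) * ∫ t in (0 : ℝ)..π, symmIntegrand f x t :=
  (hf.tendsto_hilbertTrunc_integral ha ha1 x).limUnder_eq

theorem tendsto_hilbertTrunc (ha : 0 < a) (ha1 : a < 1) (hf : HolderBound a f C) (x : ℝ) :
    Tendsto (hilbertTrunc f x) (𝓝[>] 0) (𝓝 (hilbert f x)) := by
  rw [hf.hilbert_eq ha ha1]
  exact hf.tendsto_hilbertTrunc_integral ha ha1 x

theorem hilbert_add (ha : 0 < a) (ha1 : a < 1) (hf : HolderBound a f C)
    (hg : HolderBound a g D) : hilbert (f + g) = hilbert f + hilbert g := by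
  funext x
  rw [Pi.add_apply, (hf.add hg).hilbert_eq ha ha1, hf.hilbert_eq ha ha1, hg.hilbert_eq ha ha1,
    ← mul_add, ← intervalIntegral.integral_add
      ((hf.singular_symmIntegrand ha ha1 x).intervalIntegrable ha le_rfl Real.pi_pos.le le_rfl)
      ((hg.singular_symmIntegrand ha ha1 x).intervalIntegrable ha le_rfl Real.pi_pos.le le_rfl)]
  congr 1
  refine intervalIntegral.integral_congr fun t _ => ?_
  simp only [symmIntegrand, Pi.add_apply]
  ring

theorem hilbert_smul (ha : 0 < a) (ha1 : a < 1) (hf : HolderBound a f C) (c : ℝ) :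
    hilbert (c • f) = c • hilbert f := by
  funext x
  rw [Pi.smul_apply, (hf.smul c).hilbert_eq ha ha1, hf.hilbert_eq ha ha1, smul_eq_mul,
    mul_left_comm, ← intervalIntegral.integral_const_mul c]
  congr 1
  refine intervalIntegral.integral_congr fun t _ => ?_
  simp only [symmIntegrand, Pi.smul_apply, smul_eq_mul]
  ring

theorem periodic_hilbert (ha : 0 < a) (ha1 : a < 1) (hf : HolderBound a f C) {T : ℝ}
    (hp : Function.Periodic f T) : Function.Periodic (hilbert f) T := by
  intro x
  rw [hf.hilbert_eq ha ha1, hf.hilbert_eq ha ha1]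
  have : symmIntegrand f (x + T) = symmIntegrand f x := by
    funext t
    rw [symmIntegrand, symmIntegrand, add_sub_right_comm, hp, add_right_comm, hp]
  rw [this]

theorem odd_hilbert (ha : 0 < a) (ha1 : a < 1) (hf : HolderBound a f C)
    (he : Function.Even f) : Function.Odd (hilbert f) := by
  intro x
  rw [hf.hilbert_eq ha ha1, hf.hilbert_eq ha ha1, ← mul_neg, ← intervalIntegral.integral_neg]
  congr 1
  refine intervalIntegral.integral_congr fun t _ => ?_
  have h1 : f (-x - t) = f (x + t) := by rw [← he (x + t)]; ring_nf
  have h2 : f (-x + t) = f (x - t) := by rw [← he (x - t)]; ring_nf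
  simp only [symmIntegrand, h1, h2]
  ring

theorem even_hilbert (ha : 0 < a) (ha1 : a < 1) (hf : HolderBound a f C)
    (ho : Function.Odd f) : Function.Even (hilbert f) := by
  intro x
  rw [hf.hilbert_eq ha ha1, hf.hilbert_eq ha ha1]
  congr 1
  refine intervalIntegral.integral_congr fun t _ => ?_
  have h1 : f (-x - t) = -f (x + t) := by rw [← ho (x + t)]; ring_nf
  have h2 : f (-x + t) = -f (x - t) := by rw [← ho (x - t)]; ring_nf
  simp only [symmIntegrand, h1, h2]
  ring

theorem abs_hilbert_le (ha : 0 < a) (ha1 : a < 1) (hf : HolderBound a f C) (x : ℝ) :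
    |hilbert f x| ≤ π / a * C := by
  have hC := hf.nonneg
  have hpi := Real.pi_pos
  have h := (hf.singular_symmIntegrand ha ha1 x).abs_integral_le ha hpi.le le_rfl
  have h1 : π ^ a ≤ π := by
    simpa using Real.rpow_le_rpow_of_exponent_le (x := π) (by linarith [Real.pi_gt_three]) ha1.le
  rw [hf.hilbert_eq ha ha1, abs_mul, abs_of_pos (by positivity)]
  calc 1 / (2 * π) * |∫ t in (0 : ℝ)..π, symmIntegrand f x t|
      ≤ 1 / (2 * π) * (2 * π * C * (π / a)) := by
        gcongr
        exact h.trans (by gcongr)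
    _ = π / a * C := by field_simp

/-! ### Hölder continuity of the Hilbert transform -/

/-- The second difference of an increment of a primitive of a Hölder function. -/
theorem abs_primitive_sub_le (hf : HolderBound a f C) {P : ℝ → ℝ}
    (hP : ∀ x, HasDerivAt P (f x) x) {h : ℝ} (h0 : 0 < h) (x t : ℝ) :
    |P (x + t + h) - P (x + t) - (P (x + h) - P x)| ≤ C * |t| ^ a * h := by
  have hd : ∀ s, HasDerivAt (fun s => P (s + t) - P s) (f (s + t) - f s) s := fun s =>
    ((hP (s + t)).comp_add_const s t).sub (hP s)
  have hb : ∀ s, |f (s + t) - f s| ≤ C * |t| ^ a := fun s => by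
    simpa using hf.holder (s + t) s
  have := abs_sub_le_of_hasDerivAt hd hb (x + h) x
  rw [add_sub_cancel_left, abs_of_pos h0] at this
  convert this using 2
  rw [add_right_comm x t h]
  ring

/-- The far part of Privalov's estimate. Bounding the increments of `f` by h^a against cot (t / 2)
would lose a factor log (1 / h). Instead one integrates by parts with a primitive P of `f`: the
resulting V is a mixed second difference of P, hence O(t^a h), and it faces a kernel of size t^(-2).
Since a < 1, the integral of h t^(a - 2) over (h, π) is O(h^a). The boundary term at π vanishes with
the cotangent, and the one at h is O(h^a). -/
theorem abs_integral_symmIntegrand_translate_le (ha : 0 < a) (ha1 : a < 1)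
    (hf : HolderBound a f C) (x : ℝ) {h : ℝ} (h0 : 0 < h) (h1 : h < π) :
    |∫ t in h..π, symmIntegrand (fun y => f (y + h) - f y) x t| ≤
      (2 * π + π ^ 2 / (1 - a)) * C * h ^ a := by
  have hC := hf.nonneg
  have hpi := Real.pi_pos
  have hc := hf.continuous ha
  set P : ℝ → ℝ := fun y => ∫ s in (0 : ℝ)..y, f s with hPdef
  have hP : ∀ y, HasDerivAt P (f y) y := fun y =>
    intervalIntegral.integral_hasDerivAt_right (hc.intervalIntegrable _ _)
      (hc.stronglyMeasurableAtFilter _ _) hc.continuousAt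
  have hPc : Continuous P := continuous_iff_continuousAt.2 fun y => (hP y).continuousAt
  set p : ℝ → ℝ := fun y => P (y + h) - P y with hp
  have hpd : ∀ y, HasDerivAt p (f (y + h) - f y) y := fun y =>
    ((hP (y + h)).comp_add_const y h).sub (hP y)
  set V : ℝ → ℝ := fun t => -((p (x - t) - p x) + (p (x + t) - p x)) with hV
  have hVd : ∀ t, HasDerivAt V ((f (x - t + h) - f (x - t)) - (f (x + t + h) - f (x + t))) t := by
    intro t
    have d1 : HasDerivAt (fun t => p (x - t)) (-(f (x - t + h) - f (x - t))) t :=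
      (hpd (x - t)).comp_const_sub x t
    have d2 : HasDerivAt (fun t => p (x + t)) (f (x + t + h) - f (x + t)) t :=
      (hpd (x + t)).comp_const_add x t
    exact ((d1.sub_const (p x)).add (d2.sub_const (p x))).neg.congr_deriv (by ring)
  have hVb : ∀ t, 0 < t → |V t| ≤ 2 * C * t ^ a * h := by
    intro t ht
    have b1 := hf.abs_primitive_sub_le hP h0 x t
    have b2 := hf.abs_primitive_sub_le hP h0 x (-t)
    rw [abs_neg, ← sub_eq_add_neg] at b2
    rw [abs_of_pos ht] at b1 b2
    rw [hV, abs_neg]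
    refine (abs_add_le _ _).trans ?_
    simp only [hp]
    linarith
  have hIcc : uIcc h π = Icc h π := uIcc_of_le h1.le
  have hsub : Icc h π ⊆ Ioc 0 π := fun t ht => ⟨h0.trans_le ht.1, ht.2⟩
  have hVc : Continuous V := continuous_iff_continuousAt.2 fun y => (hVd y).continuousAt
  have hparts : ∫ t in h..π, symmIntegrand (fun y => f (y + h) - f y) x t =
      -(V h * halfCot h) + ∫ t in h..π, V t * halfCsc t := by
    have := intervalIntegral.integral_deriv_mul_eq_sub (u := V) (v := halfCot)
      (u' := fun t => (f (x - t + h) - f (x - t)) - (f (x + t + h) - f (x + t)))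
      (v' := fun t => -halfCsc t) (a := h) (b := π) (fun t _ => hVd t)
      (fun t ht => hasDerivAt_halfCot (hsub (hIcc ▸ ht)))
      (Continuous.intervalIntegrable (by fun_prop) _ _)
      (ContinuousOn.intervalIntegrable (by rw [hIcc]; exact (continuousOn_halfCsc.mono hsub).neg))
    rw [halfCot_pi, mul_zero, zero_sub] at this
    rw [← this, ← intervalIntegral.integral_add]
    · refine intervalIntegral.integral_congr fun t _ => ?_
      simp only [symmIntegrand]
      ring
    · refine ContinuousOn.intervalIntegrable ?_
      rw [hIcc]
      have c1 := continuousOn_halfCot.mono hsub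
      have c2 := continuousOn_halfCsc.mono hsub
      exact ContinuousOn.add (ContinuousOn.mul (by fun_prop) c1)
        (hVc.continuousOn.mul c2.neg)
    · refine ContinuousOn.intervalIntegrable ?_
      rw [hIcc]
      exact hVc.continuousOn.mul (continuousOn_halfCsc.mono hsub)
  have e1 : |V h * halfCot h| ≤ 2 * π * C * h ^ a := by
    rw [abs_mul]
    calc |V h| * |halfCot h| ≤ (2 * C * h ^ a * h) * (π / h) :=
          mul_le_mul (hVb h h0) (abs_halfCot_le ⟨h0, h1.le⟩) (abs_nonneg _) (by positivity)
      _ = _ := by field_simp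
  have hint : ∫ t in h..π, C * h * π ^ 2 * t ^ (a - 2) =
      C * h * π ^ 2 * ((π ^ (a - 1) - h ^ (a - 1)) / (a - 1)) := by
    rw [intervalIntegral.integral_const_mul, integral_rpow]
    · norm_num [show a - 2 + 1 = a - 1 by ring]
    · refine Or.inr ⟨by linarith, ?_⟩
      rw [hIcc]
      exact fun h' => absurd h'.1 (not_le.2 h0)
  have e2 : |∫ t in h..π, V t * halfCsc t| ≤ π ^ 2 / (1 - a) * C * h ^ a := by
    have b : ‖∫ t in h..π, V t * halfCsc t‖ ≤ ∫ t in h..π, C * h * π ^ 2 * t ^ (a - 2) := by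
      refine intervalIntegral.norm_integral_le_of_norm_le h1.le (ae_of_all _ fun t ht => ?_) ?_
      · have ht0 : 0 < t := h0.trans ht.1
        rw [Real.norm_eq_abs, abs_mul]
        calc |V t| * |halfCsc t| ≤ (2 * C * t ^ a * h) * (π ^ 2 / (2 * t ^ 2)) :=
              mul_le_mul (hVb t ht0) (abs_halfCsc_le ⟨ht0, ht.2⟩) (abs_nonneg _) (by positivity)
          _ = _ := by
              rw [Real.rpow_sub ht0, show (2 : ℝ) = (2 : ℕ) by norm_num, Real.rpow_natCast]
              push_cast
              field_simp
      · refine ContinuousOn.intervalIntegrable ?_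
        rw [hIcc]
        exact continuousOn_const.mul (continuousOn_id.rpow_const fun t ht =>
          Or.inl (h0.trans_le ht.1).ne')
    rw [hint] at b
    refine b.trans ?_
    have hh : h ^ (a - 1) = h ^ a / h := Real.rpow_sub_one h0.ne' a
    have hpos : 0 ≤ π ^ (a - 1) := Real.rpow_nonneg hpi.le _
    have h1a : 0 < 1 - a := by linarith
    -- As a - 1 < 0, both signs are reversed and the contribution of the endpoint π can be dropped.
    have : (π ^ (a - 1) - h ^ (a - 1)) / (a - 1) ≤ (h ^ a / h) / (1 - a) := by
      rw [hh, ← neg_div_neg_eq, neg_sub, neg_sub]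
      gcongr
      linarith
    calc _ ≤ C * h * π ^ 2 * ((h ^ a / h) / (1 - a)) := by gcongr
      _ = _ := by field_simp
  rw [hparts]
  refine (abs_add_le _ _).trans ?_
  rw [abs_neg]
  linarith

/-- The constant of the Hölder estimate for the Hilbert transform. -/
noncomputable def hilbertConst (a : ℝ) : ℝ := 2 * (π / a + 1 + π / (1 - a))

/-- Privalov's theorem. -/
theorem hilbert (ha : 0 < a) (ha1 : a < 1) (hf : HolderBound a f C) :
    HolderBound a (hilbert f) (hilbertConst a * C) := by
  have hC := hf.nonneg
  have hpi := Real.pi_pos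
  have h1a : 0 < 1 - a := by linarith
  -- The outer factor 2 of the constant is the one that `of_le_one` loses in restricting to
  -- increments h ≤ 1.
  rw [hilbertConst, mul_assoc]
  refine of_le_one ha (fun x => (hf.abs_hilbert_le ha ha1 x).trans ?_) fun x h h0 h1 => ?_
  · gcongr
    have : 0 ≤ 1 + π / (1 - a) := by positivity
    linarith
  · have hh : h < π := h1.trans_lt (by linarith [Real.pi_gt_three])
    have hs := fun y => hf.singular_symmIntegrand ha ha1 y
    set g : ℝ → ℝ := fun y => f (y + h) - f y with hg
    have hgi : ∀ t, symmIntegrand g x t = symmIntegrand f (x + h) t - symmIntegrand f x t := by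
      intro t
      simp only [symmIntegrand, hg]
      ring_nf
    have hsg : Singular a (4 * π * C) (symmIntegrand g x) := by
      refine ⟨?_, fun t ht => ?_⟩
      · rw [funext hgi]
        exact (hs (x + h)).continuousOn.sub (hs x).continuousOn
      · rw [hgi]
        have := abs_sub (symmIntegrand f (x + h) t) (symmIntegrand f x t)
        linarith [(hs (x + h)).bound t ht, (hs x).bound t ht]
    -- Split at t = h: on (0, h) the singular bound already integrates to O(h^a), and on (h, π) the
    -- cancellation in the increment is needed.
    have hd : OddWaves.hilbert f (x + h) - OddWaves.hilbert f x =
        1 / (2 * π) * ((∫ t in (0 : ℝ)..h, symmIntegrand g x t) +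
          ∫ t in h..π, symmIntegrand g x t) := by
      rw [intervalIntegral.integral_add_adjacent_intervals
        (hsg.intervalIntegrable ha le_rfl h0.le hh.le)
        (hsg.intervalIntegrable ha h0.le hh.le le_rfl), funext hgi,
        intervalIntegral.integral_sub ((hs _).intervalIntegrable ha le_rfl hpi.le le_rfl)
        ((hs _).intervalIntegrable ha le_rfl hpi.le le_rfl), hf.hilbert_eq ha ha1,
        hf.hilbert_eq ha ha1, mul_sub]
    rw [hd, abs_mul, abs_of_pos (by positivity)]
    have e1 := hsg.abs_integral_le ha h0.le hh.le
    have e2 := hf.abs_integral_symmIntegrand_translate_le ha ha1 x h0 hh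
    have hha : 0 ≤ h ^ a := Real.rpow_nonneg h0.le _
    calc _ ≤ 1 / (2 * π) * (4 * π * C * (h ^ a / a) + (2 * π + π ^ 2 / (1 - a)) * C * h ^ a) := by
          gcongr
          exact (abs_add_le _ _).trans (add_le_add e1 e2)
      _ = (2 / a + 1 + π / (2 * (1 - a))) * (C * h ^ a) := by field_simp; ring
      _ ≤ (2 * (π / a + 1 + π / (1 - a))) * (C * h ^ a) := by
          gcongr
          have q1 : 1 / a ≤ π / a := by gcongr; linarith [Real.pi_gt_three]
          have q2 : π / (2 * (1 - a)) ≤ π / (1 - a) := by gcongr; linarith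
          have q3 : 0 ≤ π / (1 - a) := by positivity
          have q4 : 2 / a = 2 * (1 / a) := by ring
          linarith
      _ = _ := by ring

end HolderBound

theorem hilbertConst_nonneg {a : ℝ} (ha : 0 < a) (ha1 : a < 1) :
    0 ≤ HolderBound.hilbertConst a := by
  have h1a : 0 < 1 - a := by linarith
  rw [HolderBound.hilbertConst]
  have := Real.pi_pos
  positivity

/-- The Hilbert transform commutes with the derivative. -/
theorem HolderBound₁.hilbert {a C : ℝ} {f f' : ℝ → ℝ} (ha : 0 < a) (ha1 : a < 1)
    (hf : HolderBound₁ a f f' C) :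
    HolderBound₁ a (hilbert f) (hilbert f') (2 * HolderBound.hilbertConst a * C) := by
  have h0 := hf.holderBound ha ha1
  have hK := mul_nonneg (hilbertConst_nonneg ha ha1) hf.nonneg
  refine ⟨fun x => ?_, fun x => ?_, (hf.bound.hilbert ha ha1).mono (by nlinarith)⟩
  · have h := Singular.hasDerivAt_integral ha (fun x => h0.singular_symmIntegrand ha ha1 x)
      (fun x => hf.bound.singular_symmIntegrand ha ha1 x) (fun x t _ =>
        (((hf.hasDerivAt (x - t)).comp_sub_const x t).sub
          ((hf.hasDerivAt (x + t)).comp_add_const x t)).mul_const (halfCot t)) x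
    rw [hf.bound.hilbert_eq ha ha1, funext (h0.hilbert_eq ha ha1)]
    exact h.const_mul _
  · exact ((h0.hilbert ha ha1).bdd x).trans (by linarith)

/-! The commutator of the Hilbert transform with a smooth function -/

/-- The derivative of `(φ y - φ x) cot ((x - y) / 2)` with respect to `y`, at `y = x + t`,
up to sign. -/
noncomputable def taylorKernel (φ φ' : ℝ → ℝ) (x t : ℝ) : ℝ :=
  (Real.sin t * φ' (x + t) - (φ (x + t) - φ x)) * halfCsc t

/-- The symmetrized integrand of the commutator, after integration by parts. -/
noncomputable def commKernel (φ φ' G : ℝ → ℝ) (x t : ℝ) : ℝ :=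
  taylorKernel φ φ' x t * G (x + t) + taylorKernel φ φ' x (-t) * G (x - t)

/-- The commutator of the Hilbert transform and `φ`, applied to the derivative of `G`. -/
noncomputable def commIntegral (φ φ' G : ℝ → ℝ) (x : ℝ) : ℝ :=
  1 / (2 * π) * ∫ t in (0 : ℝ)..π, commKernel φ φ' G x t

variable {a A B : ℝ} {φ φ' φ'' φ''' G G' : ℝ → ℝ}

/-- Taylor expansion based at the endpoint x + s: the mean value inequality for z ↦ φ z - z φ' (x +
s), whose derivative is an increment of φ' over a distance at most |s|. -/
theorem abs_taylor_sub_le (ha : 0 < a) (hd : ∀ x, HasDerivAt φ (φ' x) x)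
    (hb : HolderBound a φ' A) (x s : ℝ) :
    |φ (x + s) - φ x - s * φ' (x + s)| ≤ A * |s| ^ a * |s| := by
  have h := (convex_uIcc x (x + s)).norm_image_sub_le_of_norm_hasDerivWithin_le
    (f := fun z => φ z - z * φ' (x + s)) (f' := fun z => φ' z - 1 * φ' (x + s))
    (C := A * |s| ^ a)
    (fun z _ => ((hd z).sub ((hasDerivAt_id z).mul_const (φ' (x + s)))).hasDerivWithinAt)
    (fun z hz => ?_) left_mem_uIcc right_mem_uIcc
  · rw [add_sub_cancel_left, Real.norm_eq_abs, Real.norm_eq_abs] at h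
    convert h using 2
    ring
  · rw [Real.norm_eq_abs, one_mul]
    refine (hb.holder z (x + s)).trans (mul_le_mul_of_nonneg_left ?_ hb.nonneg)
    have := abs_sub_right_of_mem_uIcc hz
    rw [add_sub_cancel_left, abs_sub_comm] at this
    exact Real.rpow_le_rpow (abs_nonneg _) this ha.le

theorem le_pi_mul_rpow (ha : 0 < a) (ha1 : a < 1) {t : ℝ} (ht : t ∈ Ioc 0 π) :
    t ≤ π * t ^ a := by
  have h0 : 0 ≤ t ^ a := Real.rpow_nonneg ht.1.le _
  have hpi := Real.pi_gt_three
  rcases le_or_gt t 1 with h | h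
  · have h1 : t ≤ t ^ a := by
      simpa using Real.rpow_le_rpow_of_exponent_ge ht.1 h ha1.le
    nlinarith
  · have h1 : 1 ≤ t ^ a := Real.one_le_rpow h.le ha.le
    nlinarith [ht.2]

/-- With s in place of sin s, the numerator is a Taylor remainder of size t^(1 + a). The replacement
costs t², which is of the same order on (0, π] because t ≤ π t^a. Division by sin² (s / 2) leaves
t^(a - 1). -/
theorem abs_taylorKernel_le (ha : 0 < a) (ha1 : a < 1) (hd : ∀ x, HasDerivAt φ (φ' x) x)
    (hb : HolderBound a φ' A) (x : ℝ) {s t : ℝ} (hs : |s| = t) (ht : t ∈ Ioc 0 π) :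
    |taylorKernel φ φ' x s| ≤ π ^ 3 * A * t ^ (a - 1) := by
  have h0 := ht.1
  have hA := hb.nonneg
  have hpi := Real.pi_gt_three
  have hta : 0 ≤ t ^ a := Real.rpow_nonneg h0.le _
  have hsin : |Real.sin s - s| ≤ t ^ 2 := by
    rcases (eq_or_eq_neg_of_abs_eq hs) with rfl | rfl
    · exact abs_sin_sub_self_le h0
    · rw [Real.sin_neg, neg_sub_neg, abs_sub_comm]
      exact abs_sin_sub_self_le h0
  have hcsc : |halfCsc s| ≤ π ^ 2 / (2 * t ^ 2) := by
    rcases (eq_or_eq_neg_of_abs_eq hs) with rfl | rfl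
    · exact abs_halfCsc_le ht
    · rw [halfCsc_neg]
      exact abs_halfCsc_le ht
  have h1 := abs_taylor_sub_le ha hd hb x s
  rw [hs] at h1
  have h2 : |Real.sin s * φ' (x + s) - (φ (x + s) - φ x)| ≤ 2 * π * A * (t * t ^ a) := by
    have e : Real.sin s * φ' (x + s) - (φ (x + s) - φ x) =
      (Real.sin s - s) * φ' (x + s) - (φ (x + s) - φ x - s * φ' (x + s)) := by ring
    rw [e]
    refine (abs_sub _ _).trans ?_
    rw [abs_mul]
    have h3 := mul_le_mul hsin (hb.bdd (x + s)) (abs_nonneg _) (sq_nonneg t)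
    have h4 := mul_le_mul_of_nonneg_left (le_pi_mul_rpow ha ha1 ht) (mul_nonneg hA h0.le)
    have h5 : 0 ≤ A * (t * t ^ a) := by positivity
    nlinarith
  rw [taylorKernel, abs_mul, Real.rpow_sub_one h0.ne']
  calc _ ≤ 2 * π * A * (t * t ^ a) * (π ^ 2 / (2 * t ^ 2)) :=
        mul_le_mul h2 hcsc (abs_nonneg _) (by positivity)
    _ = _ := by field_simp

theorem singular_commKernel (ha : 0 < a) (ha1 : a < 1) (hd : ∀ x, HasDerivAt φ (φ' x) x)
    (hb : HolderBound a φ' A) (hG : Continuous G) (hGb : ∀ x, |G x| ≤ B) (x : ℝ) :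
    Singular a (2 * π ^ 3 * (A * B)) (commKernel φ φ' G x) := by
  have hφ : Continuous φ := continuous_iff_continuousAt.2 fun y => (hd y).continuousAt
  have hφ' := hb.continuous ha
  have hA := hb.nonneg
  have hB : 0 ≤ B := (abs_nonneg _).trans (hGb 0)
  refine ⟨?_, fun t ht => ?_⟩
  · unfold commKernel taylorKernel
    simp only [halfCsc_neg]
    exact ((ContinuousOn.mul (by fun_prop) continuousOn_halfCsc).mul (by fun_prop)).add
      ((ContinuousOn.mul (by fun_prop) continuousOn_halfCsc).mul (by fun_prop))
  · have h1 := abs_taylorKernel_le ha ha1 hd hb x (abs_of_pos ht.1) ht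
    have h2 := abs_taylorKernel_le ha ha1 hd hb x ((abs_neg t).trans (abs_of_pos ht.1)) ht
    have ht0 : 0 ≤ t ^ (a - 1) := Real.rpow_nonneg ht.1.le _
    have hpi := Real.pi_pos
    have h3 := mul_le_mul h1 (hGb (x + t)) (abs_nonneg _) (by positivity)
    have h4 := mul_le_mul h2 (hGb (x - t)) (abs_nonneg _) (by positivity)
    rw [← abs_mul] at h3 h4
    refine (abs_add_le _ _).trans ((add_le_add h3 h4).trans (le_of_eq ?_))
    ring

/-- Only the supremum of G and the Hölder bound of φ' enter, so the estimate also applies to the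
derivative of G and to increments of φ and of G. -/
theorem abs_commIntegral_le (ha : 0 < a) (ha1 : a < 1) (hd : ∀ x, HasDerivAt φ (φ' x) x)
    (hb : HolderBound a φ' A) (hG : Continuous G) (hGb : ∀ x, |G x| ≤ B) (x : ℝ) :
    |commIntegral φ φ' G x| ≤ π ^ 3 / a * (A * B) := by
  have hA := hb.nonneg
  have hB : 0 ≤ B := (abs_nonneg _).trans (hGb 0)
  have hpi := Real.pi_pos
  have h := (singular_commKernel ha ha1 hd hb hG hGb x).abs_integral_le ha hpi.le le_rfl
  have h1 : π ^ a ≤ π := by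
    simpa using Real.rpow_le_rpow_of_exponent_le (x := π) (by linarith [Real.pi_gt_three]) ha1.le
  rw [commIntegral, abs_mul, abs_of_pos (by positivity)]
  calc _ ≤ 1 / (2 * π) * (2 * π ^ 3 * (A * B) * (π / a)) := by
        gcongr
        exact h.trans (by gcongr)
    _ = _ := by field_simp

/-- The kernel is linear in φ with coefficients that depend on t only. Differentiation in x thus
obeys the product rule and produces two operators of the same form. -/
theorem hasDerivAt_commIntegral (ha : 0 < a) (ha1 : a < 1) (hd : ∀ x, HasDerivAt φ (φ' x) x)
    (hd' : ∀ x, HasDerivAt φ' (φ'' x) x) (hb : HolderBound a φ' A) (hb' : HolderBound a φ'' A)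
    (hG : HolderBound₁ a G G' B) (x : ℝ) :
    HasDerivAt (commIntegral φ φ' G) (commIntegral φ' φ'' G x + commIntegral φ φ' G' x) x := by
  have hGc := hG.continuous
  have hGc' := hG.bound.continuous ha
  have s1 := singular_commKernel ha ha1 hd hb hGc hG.bdd
  have s2 := singular_commKernel ha ha1 hd' hb' hGc hG.bdd
  have s3 := singular_commKernel ha ha1 hd hb hGc' hG.bound.bdd
  have h := Singular.hasDerivAt_integral ha s1 (fun x => (s2 x).add (s3 x)) (fun x t _ => ?_) x
  · rw [intervalIntegral.integral_add
      ((s2 x).intervalIntegrable ha le_rfl Real.pi_pos.le le_rfl)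
      ((s3 x).intervalIntegrable ha le_rfl Real.pi_pos.le le_rfl)] at h
    rw [commIntegral, commIntegral, ← mul_add]
    exact h.const_mul _
  · have k : ∀ s, HasDerivAt (fun x => taylorKernel φ φ' x s) (taylorKernel φ' φ'' x s) x :=
      fun s => (((((hd' (x + s)).comp_add_const x s).const_mul (Real.sin s)).sub
        (((hd (x + s)).comp_add_const x s).sub (hd x))).mul_const (halfCsc s))
    refine (((k t).mul ((hG.hasDerivAt (x + t)).comp_add_const x t)).add
      ((k (-t)).mul ((hG.hasDerivAt (x - t)).comp_sub_const x t))).congr_deriv ?_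
    simp only [commKernel]
    ring

/-- One derivative buys the full factor h, in the Hölder seminorm too: there the mean value
inequality is applied in s to φ (x + s) - φ (y + s). -/
theorem HolderBound.translate_sub (hd : ∀ x, HasDerivAt φ (φ' x) x) (hb : HolderBound a φ' A)
    {h : ℝ} (h0 : 0 < h) : HolderBound a (fun x => φ (x + h) - φ x) (A * h) := by
  refine ⟨fun x => ?_, fun x y => ?_⟩
  · simpa [abs_of_pos h0] using abs_sub_le_of_hasDerivAt hd hb.bdd (x + h) x
  · have h1 := abs_sub_le_of_hasDerivAt (f := fun s => φ (x + s) - φ (y + s))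
      (fun s => ((hd (x + s)).comp_const_add x s).sub ((hd (y + s)).comp_const_add y s))
      (C := A * |x - y| ^ a) (fun s => by simpa using hb.holder (x + s) (y + s)) h 0
    rw [sub_zero, abs_of_pos h0, add_zero, add_zero] at h1
    calc _ = |φ (x + h) - φ (y + h) - (φ x - φ y)| := by congr 1; ring
      _ ≤ _ := h1.trans (le_of_eq (by ring))

/-- A discrete product rule: the increment falls either on φ, where it costs O(h) ≤ O(h^a), or on G,
where it costs O(h^a). -/
theorem abs_commIntegral_translate_le (ha : 0 < a) (ha1 : a < 1)
    (hd : ∀ x, HasDerivAt φ (φ' x) x) (hd' : ∀ x, HasDerivAt φ' (φ'' x) x)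
    (hb : HolderBound a φ' A) (hb' : HolderBound a φ'' A) (hG : HolderBound a G B) (x : ℝ) {h : ℝ}
    (h0 : 0 < h) (h1 : h ≤ 1) :
    |commIntegral φ φ' G (x + h) - commIntegral φ φ' G x| ≤
      2 * (π ^ 3 / a * (A * B)) * h ^ a := by
  have hA := hb.nonneg
  have hB := hG.nonneg
  have hGc := hG.continuous ha
  have hdh : ∀ x, HasDerivAt (fun x => φ (x + h) - φ x) (φ' (x + h) - φ' x) x := fun x =>
    ((hd (x + h)).comp_add_const x h).sub (hd x)
  have hbh := HolderBound.translate_sub hd' hb' h0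
  have hGb : ∀ x, |G (x + h)| ≤ B := fun x => hG.bdd _
  have hGt : Continuous fun x => G (x + h) := by fun_prop
  have hGs : Continuous fun x => G (x + h) - G x := by fun_prop
  have s1 := singular_commKernel ha ha1 hdh hbh hGt hGb x
  have s2 := singular_commKernel ha ha1 hd hb
    hGs (fun x => hG.abs_translate_sub_le h0 x) x
  have s3 := fun y => (singular_commKernel ha ha1 hd hb hGc hG.bdd y).intervalIntegrable ha
    le_rfl Real.pi_pos.le le_rfl
  have key : commIntegral φ φ' G (x + h) - commIntegral φ φ' G x =
      commIntegral (fun x => φ (x + h) - φ x) (fun x => φ' (x + h) - φ' x) (fun x => G (x + h)) x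
        + commIntegral φ φ' (fun x => G (x + h) - G x) x := by
    rw [commIntegral, commIntegral, commIntegral, commIntegral, ← mul_sub, ← mul_add,
      ← intervalIntegral.integral_sub (s3 _) (s3 _), ← intervalIntegral.integral_add
        (s1.intervalIntegrable ha le_rfl Real.pi_pos.le le_rfl)
        (s2.intervalIntegrable ha le_rfl Real.pi_pos.le le_rfl)]
    congr 1
    refine intervalIntegral.integral_congr fun t _ => ?_
    simp only [commKernel, taylorKernel, add_right_comm x h,
      add_sub_right_comm x h]
    ring
  rw [key]
  refine (abs_add_le _ _).trans ?_
  have e1 := abs_commIntegral_le ha ha1 hdh hbh hGt hGb x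
  have e2 := abs_commIntegral_le ha ha1 hd hb
    hGs (fun x => hG.abs_translate_sub_le h0 x) x
  have h3 : h ≤ h ^ a := by
    simpa using Real.rpow_le_rpow_of_exponent_ge h0 h1 ha1.le
  have hc : 0 ≤ π ^ 3 / a := by have := Real.pi_pos; positivity
  have e3 : π ^ 3 / a * (A * h * B) ≤ π ^ 3 / a * (A * B) * h ^ a := by
    calc _ = π ^ 3 / a * (A * B) * h := by ring
      _ ≤ _ := by gcongr
  calc _ ≤ π ^ 3 / a * (A * h * B) + π ^ 3 / a * (A * (B * h ^ a)) := add_le_add e1 e2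
    _ ≤ _ := by linarith

/-- The smoothing property of the commutator. -/
theorem holderBound₁_commIntegral (ha : 0 < a) (ha1 : a < 1)
    (hd : ∀ x, HasDerivAt φ (φ' x) x) (hd' : ∀ x, HasDerivAt φ' (φ'' x) x)
    (hd'' : ∀ x, HasDerivAt φ'' (φ''' x) x) (hb' : HolderBound a φ' A)
    (hb'' : HolderBound a φ'' A) (hb''' : HolderBound a φ''' A) (hG : HolderBound₁ a G G' B) :
    HolderBound₁ a (commIntegral φ φ' G) (commIntegral φ' φ'' G + commIntegral φ φ' G')
      (6 * (π ^ 3 / a) * (A * B)) := by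
  have hA := hb'.nonneg
  have hB := hG.nonneg
  have hGc := hG.continuous
  have hGc' := hG.bound.continuous ha
  have hc : 0 ≤ π ^ 3 / a := by have := Real.pi_pos; positivity
  have hcAB : 0 ≤ π ^ 3 / a * (A * B) := by positivity
  refine ⟨hasDerivAt_commIntegral ha ha1 hd hd' hb' hb'' hG, fun x => ?_, ?_⟩
  · linarith [abs_commIntegral_le ha ha1 hd hb' hGc hG.bdd x]
  -- The 2 is that of `of_le_one`; 3 = 2 + 1, as the Hölder constant of G is 2B and that of G' is B.
  · rw [show 6 * (π ^ 3 / a) * (A * B) = 2 * (3 * (π ^ 3 / a) * (A * B)) by ring]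
    refine HolderBound.of_le_one ha (fun x => ?_) fun x h h0 h1 => ?_
    · refine (abs_add_le _ _).trans ?_
      linarith [abs_commIntegral_le ha ha1 hd' hb'' hGc hG.bdd x,
        abs_commIntegral_le ha ha1 hd hb' hGc' hG.bound.bdd x]
    · rw [Pi.add_apply, Pi.add_apply, add_sub_add_comm]
      refine (abs_add_le _ _).trans ?_
      have e1 := abs_commIntegral_translate_le ha ha1 hd' hd'' hb'' hb''' (hG.holderBound ha ha1)
        x h0 h1
      have e2 := abs_commIntegral_translate_le ha ha1 hd hd' hb' hb'' hG.bound x h0 h1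
      linarith

/-- Integration by parts in the truncated commutator. -/
theorem integral_symmIntegrand_mul_sub (ha : 0 < a) (hd : ∀ x, HasDerivAt φ (φ' x) x)
    (hb : HolderBound a φ' A) (hG : HolderBound₁ a G G' B) (x : ℝ) {δ : ℝ} (hδ : δ ∈ Ioo 0 π) :
    (∫ t in δ..π, symmIntegrand (φ * G') x t) - φ x * (∫ t in δ..π, symmIntegrand G' x t) =
      (∫ t in δ..π, commKernel φ φ' G x t) +
      ((φ (x - δ) - φ x) * G (x - δ) + (φ (x + δ) - φ x) * G (x + δ)) * halfCot δ := by
  have hφc : Continuous φ := continuous_iff_continuousAt.2 fun y => (hd y).continuousAt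
  have hφc' := hb.continuous ha
  have hGc := hG.continuous
  have hGc' := hG.bound.continuous ha
  have hIcc : uIcc δ π = Icc δ π := uIcc_of_le hδ.2.le
  have hsub : Icc δ π ⊆ Ioc 0 π := fun t ht => ⟨hδ.1.trans_le ht.1, ht.2⟩
  have c1 := continuousOn_halfCot.mono hsub
  have c2 := continuousOn_halfCsc.mono hsub
  set N : ℝ → ℝ := fun t => (φ (x - t) - φ x) * G (x - t) + (φ (x + t) - φ x) * G (x + t) with hN
  set N' : ℝ → ℝ := fun t => (-φ' (x - t) * G (x - t) + (φ (x - t) - φ x) * -G' (x - t)) +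
    (φ' (x + t) * G (x + t) + (φ (x + t) - φ x) * G' (x + t)) with hN'
  have hNd : ∀ t, HasDerivAt N (N' t) t := fun t =>
    ((((hd (x - t)).comp_const_sub x t).sub_const (φ x)).mul
      ((hG.hasDerivAt (x - t)).comp_const_sub x t)).add
    ((((hd (x + t)).comp_const_add x t).sub_const (φ x)).mul
      ((hG.hasDerivAt (x + t)).comp_const_add x t))
  have hNc : Continuous N := by fun_prop
  have hNc' : Continuous N' := by fun_prop
  have parts := intervalIntegral.integral_deriv_mul_eq_sub (u := N) (v := halfCot) (u' := N')
    (v' := fun t => -halfCsc t) (a := δ) (b := π) (fun t _ => hNd t)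
    (fun t ht => hasDerivAt_halfCot (hsub (hIcc ▸ ht)))
    (hNc'.intervalIntegrable _ _)
    (ContinuousOn.intervalIntegrable (by rw [hIcc]; exact c2.neg))
  rw [halfCot_pi, mul_zero, zero_sub] at parts
  rw [← sub_eq_iff_eq_add', ← neg_eq_iff_eq_neg.2 parts, ← intervalIntegral.integral_neg,
    ← intervalIntegral.integral_const_mul, ← intervalIntegral.integral_sub,
    ← intervalIntegral.integral_sub]
  · refine intervalIntegral.integral_congr fun t ht => ?_
    -- Writing the cotangent as sin t times `halfCsc t` gives the terms with φ' and those with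
    -- increments of φ a common factor; this is how the sine enters `taylorKernel`.
    have := halfCot_eq (hsub (hIcc ▸ ht))
    simp only [symmIntegrand, commKernel, taylorKernel, hN, hN', Pi.mul_apply, halfCsc_neg,
      Real.sin_neg, this, ← sub_eq_add_neg]
    ring
  · refine ContinuousOn.intervalIntegrable ?_
    rw [hIcc]
    exact (ContinuousOn.mul (by fun_prop) c1).sub
      (continuousOn_const.mul (ContinuousOn.mul (by fun_prop) c1))
  · refine ContinuousOn.intervalIntegrable ?_
    rw [hIcc]
    unfold commKernel taylorKernel
    simp only [halfCsc_neg]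
    exact ((ContinuousOn.mul (by fun_prop) c2).mul (by fun_prop)).add
      ((ContinuousOn.mul (by fun_prop) c2).mul (by fun_prop))
  · refine ContinuousOn.intervalIntegrable ?_
    rw [hIcc]
    exact ContinuousOn.mul (by fun_prop) c1
  · refine ContinuousOn.intervalIntegrable ?_
    rw [hIcc]
    exact continuousOn_const.mul (ContinuousOn.mul (by fun_prop) c1)

/-- The bracket vanishes at δ = 0 together with its derivative, since the contributions of x - δ and
x + δ cancel. It is therefore o(δ), against a cotangent bounded by π / δ. -/
theorem tendsto_boundary_term (hd : ∀ x, HasDerivAt φ (φ' x) x)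
    (hG : ∀ x, HasDerivAt G (G' x) x) (x : ℝ) :
    Tendsto (fun δ => ((φ (x - δ) - φ x) * G (x - δ) + (φ (x + δ) - φ x) * G (x + δ)) * halfCot δ)
      (𝓝[>] 0) (𝓝 0) := by
  set N : ℝ → ℝ := fun t => (φ (x - t) - φ x) * G (x - t) + (φ (x + t) - φ x) * G (x + t) with hN
  have hNd := ((((hd (x - 0)).comp_const_sub x 0).sub_const (φ x)).mul
      ((hG (x - 0)).comp_const_sub x 0)).add
    ((((hd (x + 0)).comp_const_add x 0).sub_const (φ x)).mul ((hG (x + 0)).comp_const_add x 0))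
  have hNd' : HasDerivAt N 0 0 := hNd.congr_deriv (by simp)
  have hN0 : N 0 = 0 := by simp [hN]
  have h1 : Tendsto (fun δ => π * |δ⁻¹ * N δ|) (𝓝[>] 0) (𝓝 0) := by
    have := (hNd'.tendsto_slope_zero_right.abs.const_mul π)
    simpa [hN0] using this
  refine squeeze_zero_norm' ?_ h1
  filter_upwards [Ioo_mem_nhdsGT Real.pi_pos] with δ hδ
  rw [Real.norm_eq_abs, abs_mul, abs_mul, abs_inv, abs_of_pos hδ.1]
  calc |N δ| * |halfCot δ| ≤ |N δ| * (π / δ) := by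
        gcongr
        exact abs_halfCot_le ⟨hδ.1, hδ.2.le⟩
    _ = _ := by ring

/-- The limit δ → 0 of the integration by parts. No derivative of G is left on the right, so the
commutator can gain the derivative that G' lacks. -/
theorem commutator_hilbert_eq (ha : 0 < a) (ha1 : a < 1) (hφ : HolderBound₁ a φ φ' A)
    (hG : HolderBound₁ a G G' B) :
    commutator hilbert φ G' = commIntegral φ φ' G := by
  funext x
  have hφh := hφ.holderBound ha ha1
  have hp := hφh.mul hG.bound
  have t1 := (hp.tendsto_hilbertTrunc ha ha1 x).sub
    ((hG.bound.tendsto_hilbertTrunc ha ha1 x).const_mul (φ x))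
  have s := singular_commKernel ha ha1 hφ.hasDerivAt hφ.bound hG.continuous hG.bdd x
  have t2 := ((s.tendsto_integral ha).add
    (tendsto_boundary_term hφ.hasDerivAt hG.hasDerivAt x)).const_mul (1 / (2 * π))
  rw [add_zero] at t2
  refine tendsto_nhds_unique t1 (t2.congr' ?_)
  filter_upwards [Ioo_mem_nhdsGT Real.pi_pos] with δ hδ
  rw [hilbertTrunc_eq (hp.continuous ha) x hδ, hilbertTrunc_eq (hG.bound.continuous ha) x hδ,
    ← integral_symmIntegrand_mul_sub ha hφ.hasDerivAt hφ.bound hG x hδ]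
  ring

/-! Sine series of odd functions -/

theorem hasSum_of_forall_eq {ι E : Type*} [AddCommMonoid E] [TopologicalSpace E] {f g : ι → E}
    {s : E} (hf : HasSum f s) (h : ∀ i, g i = f i) : HasSum g s := by
  rwa [funext h]

/-- The n-th coefficient of f is, in modulus, that of f' divided by |n|, hence at most |cₙ(f')|² + 1
/ n². Parseval for f' makes the first term summable. -/
theorem summable_fourierCoeffOn_of_hasDerivAt {f f' : ℝ → ℝ}
    (hp : Function.Periodic f (2 * π)) (hd : ∀ x, HasDerivAt f (f' x) x) (hc : Continuous f') :
    Summable (fourierCoeffOn Real.two_pi_pos fun x => (f x : ℂ)) := by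
  have hc' : Continuous fun x => (f' x : ℂ) := by fun_prop
  have hL2 : MemLp (fun x => (f' x : ℂ)) 2 (volume.restrict (Ioc 0 (2 * π))) := by
    obtain ⟨C, hC⟩ := (isCompact_Icc (a := (0 : ℝ)) (b := 2 * π)).exists_bound_of_continuousOn
      hc'.continuousOn
    exact MemLp.of_bound hc'.aestronglyMeasurable C
      ((ae_restrict_mem measurableSet_Ioc).mono fun x hx => hC x (Ioc_subset_Icc_self hx))
  have h1 := (hasSum_sq_fourierCoeffOn Real.two_pi_pos hL2).summable
  have h2 : Summable fun n : ℤ => 1 / (n : ℝ) ^ 2 := Real.summable_one_div_int_pow.2 one_lt_two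
  refine Summable.of_norm_bounded_eventually (h1.add h2) ?_
  have h0 : ∀ᶠ n : ℤ in cofinite, n ≠ 0 := (Set.finite_singleton (0 : ℤ)).compl_mem_cofinite
  filter_upwards [h0] with n hn
  have hper : f (2 * π) = f 0 := by simpa using hp 0
  rw [fourierCoeffOn_of_hasDerivAt Real.two_pi_pos hn (fun x _ => (hd x).ofReal_comp)
    (hc'.intervalIntegrable _ _), hper, sub_self, mul_zero, zero_sub]
  set c := fourierCoeffOn Real.two_pi_pos (fun x => (f' x : ℂ)) n
  have hn' : 0 < |(n : ℝ)| := abs_pos.2 (Int.cast_ne_zero.2 hn)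
  have e : ‖1 / (-2 * π * Complex.I * n) * -(((2 * π : ℝ) - (0 : ℝ) : ℂ) * c)‖ =
      ‖c‖ * (1 / |(n : ℝ)|) := by
    simp only [norm_mul, norm_div, norm_neg, norm_one, Complex.norm_I, Complex.norm_real,
      Complex.norm_intCast, Complex.ofReal_zero, sub_zero, Complex.norm_ofNat, Real.norm_ofNat,
      Real.norm_eq_abs, abs_of_pos Real.pi_pos]
    have := Real.pi_pos
    field_simp
  rw [e]
  have e2 : 1 / (n : ℝ) ^ 2 = (1 / |(n : ℝ)|) ^ 2 := by rw [div_pow, sq_abs, one_pow]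
  rw [e2]
  nlinarith [sq_nonneg (‖c‖ - 1 / |(n : ℝ)|), sq_nonneg (‖c‖), sq_nonneg (1 / |(n : ℝ)|)]

theorem hasSum_fourierCoeffOn {f f' : ℝ → ℝ}
    (hp : Function.Periodic f (2 * π)) (hd : ∀ x, HasDerivAt f (f' x) x) (hc : Continuous f')
    (x : ℝ) : HasSum (fun n : ℤ => fourierCoeffOn Real.two_pi_pos (fun x => (f x : ℂ)) n *
      Complex.exp (n * x * Complex.I)) (f x) := by
  have : Fact (0 < 2 * π) := ⟨Real.two_pi_pos⟩
  have hfc : Continuous f := continuous_iff_continuousAt.2 fun y => (hd y).continuousAt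
  have hpc : Function.Periodic (fun x => (f x : ℂ)) (2 * π) := fun x => congrArg _ (hp x)
  have hlc : Continuous (hpc.lift : AddCircle (2 * π) → ℂ) :=
    continuous_quot_lift _ (by fun_prop : Continuous fun x => (f x : ℂ))
  let L : C(AddCircle (2 * π), ℂ) := ⟨hpc.lift, hlc⟩
  have hcoef : fourierCoeff L = fourierCoeffOn Real.two_pi_pos fun x => (f x : ℂ) := by
    funext n
    rw [fourierCoeff_eq_intervalIntegral _ n 0, fourierCoeffOn_eq_integral, zero_add, sub_zero]
    congr 1
  have hs : Summable (fourierCoeff L) := by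
    rw [hcoef]; exact summable_fourierCoeffOn_of_hasDerivAt hp hd hc
  have h := has_pointwise_sum_fourier_series_of_summable hs (x : AddCircle (2 * π))
  rw [hcoef] at h
  have hL : L (x : AddCircle (2 * π)) = f x := rfl
  rw [hL] at h
  refine hasSum_of_forall_eq h fun n => ?_
  have hpi : (π : ℂ) ≠ 0 := Complex.ofReal_ne_zero.2 Real.pi_ne_zero
  rw [fourier_coe_apply, smul_eq_mul]
  congr 2
  push_cast
  field_simp

theorem exists_hasSum_sin_of_odd {f f' : ℝ → ℝ} (ho : Function.Odd f)
    (hp : Function.Periodic f (2 * π)) (hd : ∀ x, HasDerivAt f (f' x) x) (hc : Continuous f') :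
    ∃ u : ℕ → ℝ, ∀ x : ℝ,
      HasSum (fun k : ℕ => u (k + 1) * Real.sin ((k + 1 : ℕ) * x)) (f x) := by
  set c := fourierCoeffOn Real.two_pi_pos fun x => (f x : ℂ)
  -- By oddness f x = (f x - f (-x)) / 2, which keeps only the sines; the real part of i cₙ is -Im
  -- cₙ.
  have h : ∀ x, HasSum (fun n : ℤ => -(c n).im * Real.sin (n * x)) (f x) := by
    intro x
    have h1 := hasSum_fourierCoeffOn hp hd hc x
    have h2 := hasSum_fourierCoeffOn hp hd hc (-x)
    have h3 := Complex.reCLM.hasSum ((h1.sub h2).div_const 2)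
    rw [ho x] at h3
    convert h3 using 1
    · funext n
      have e : c n * Complex.exp (n * x * Complex.I) - c n * Complex.exp (n * (-x : ℝ) * Complex.I)
          = c n * (2 * ((Real.sin (n * x) : ℝ) : ℂ) * Complex.I) := by
        rw [← mul_sub]
        push_cast
        rw [Complex.sin, mul_neg, neg_mul]
        linear_combination (c n) * (Complex.exp (n * x * Complex.I) -
          Complex.exp (-(n * x * Complex.I))) * Complex.I_mul_I
      have e' : (c n * Complex.exp (n * x * Complex.I) -
          c n * Complex.exp (n * (-x : ℝ) * Complex.I)) / 2 = (Real.sin (n * x) : ℂ) * (c n * Complex.I) := by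
        rw [e]; push_cast; ring
      simp only [Complex.reCLM_apply]
      rw [e', Complex.re_ofReal_mul]
      simp [mul_comm]
    · simp
  -- The frequencies n and -n are paired, the sine changing sign. The pairing counts n = 0 twice,
  -- harmlessly since sin 0 = 0, and the sum then starts at k + 1.
  refine ⟨fun k => -(c k).im + (c (-k)).im, fun x => ?_⟩
  have h4 := (h x).nat_add_neg
  rw [← hasSum_nat_add_iff' 1] at h4
  simp only [Finset.range_one, Finset.sum_singleton] at h4
  have e1 : f x = f x + -(c 0).im * Real.sin ((0 : ℤ) * x) -
      (-(c ((0 : ℕ) : ℤ)).im * Real.sin (((0 : ℕ) : ℤ) * x) +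
        -(c (-((0 : ℕ) : ℤ))).im * Real.sin ((-((0 : ℕ) : ℤ) : ℤ) * x)) := by simp
  rw [e1]
  refine hasSum_of_forall_eq h4 fun k => ?_
  have e2 : (((-((k + 1 : ℕ) : ℤ)) : ℤ) : ℝ) * x = -(((k + 1 : ℕ) : ℝ) * x) := by
    push_cast; ring
  rw [e2, Real.sin_neg, Int.cast_natCast]
  ring

/-! The operators between the Hölder spaces -/

namespace Holder

variable {k : ℕ} {a : ℝ}

theorem abs_iteratedDeriv_le (f : Holder k a) {l : ℕ} (hl : l ≤ k) (x : ℝ) :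
    |iteratedDeriv l f x| ≤ ‖f‖ := by
  have h1 : ∀ l ∈ Finset.range (k + 1), 0 ≤ supNorm (iteratedDeriv l f) :=
    fun l _ => supNorm_nonneg _
  exact (le_supNorm (f.bdd_iteratedDeriv hl) x).trans
    ((Finset.single_le_sum h1 (Finset.mem_range_succ_iff.2 hl)).trans
      (le_add_of_nonneg_right (supNorm_nonneg _)))

theorem abs_iteratedDeriv_sub_le (ha : 0 < a) (f : Holder k a) (x y : ℝ) :
    |iteratedDeriv k f x - iteratedDeriv k f y| ≤ ‖f‖ * |x - y| ^ a := by
  rcases eq_or_ne x y with rfl | hxy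
  · simp [Real.zero_rpow ha.ne']
  · have h0 : 0 < |x - y| ^ a := Real.rpow_pos_of_pos (abs_pos.2 (sub_ne_zero.2 hxy)) a
    have h1 := le_supNorm f.bdd_holderQuot (x, y)
    rw [holderQuot, abs_div, abs_of_pos h0, div_le_iff₀ h0] at h1
    refine h1.trans (mul_le_mul_of_nonneg_right ?_ h0.le)
    exact le_add_of_nonneg_left (Finset.sum_nonneg fun _ _ => supNorm_nonneg _)

theorem hasDerivAt_iteratedDeriv (f : Holder k a) {l : ℕ} (hl : l < k) (x : ℝ) :
    HasDerivAt (iteratedDeriv l f) (iteratedDeriv (l + 1) f x) x := by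
  rw [iteratedDeriv_succ]
  have h := f.contDiff.differentiable_iteratedDeriv l (by exact_mod_cast hl)
  exact h.differentiableAt.hasDerivAt

theorem holderBound_iteratedDeriv (ha : 0 < a) (ha1 : a < 1) (f : Holder k a) {l : ℕ}
    (hl : l ≤ k) : HolderBound a (iteratedDeriv l f) (2 * ‖f‖) := by
  rcases hl.lt_or_eq with h | rfl
  · exact .of_hasDerivAt ha ha1 (f.hasDerivAt_iteratedDeriv h) (f.abs_iteratedDeriv_le hl)
      (f.abs_iteratedDeriv_le h)
  · refine HolderBound.mono ⟨f.abs_iteratedDeriv_le le_rfl, f.abs_iteratedDeriv_sub_le ha⟩ ?_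
    linarith [norm_nonneg f]

theorem holderBound₁_iteratedDeriv (ha : 0 < a) (ha1 : a < 1) (f : Holder k a) {l : ℕ}
    (hl : l < k) :
    HolderBound₁ a (iteratedDeriv l f) (iteratedDeriv (l + 1) f) (2 * ‖f‖) :=
  ⟨f.hasDerivAt_iteratedDeriv hl,
    fun x => (f.abs_iteratedDeriv_le hl.le x).trans (by linarith [norm_nonneg f]),
    f.holderBound_iteratedDeriv ha ha1 hl⟩

theorem periodic_iteratedDeriv (f : Holder k a) (l : ℕ) :
    Function.Periodic (iteratedDeriv l f) (2 * π) := by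
  intro x
  have h : (fun z => (f : ℝ → ℝ) (z + 2 * π)) = f := funext f.periodic
  have h2 := congrFun (iteratedDeriv_comp_add_const l (f : ℝ → ℝ) (2 * π)) x
  rw [h] at h2
  exact h2.symm

theorem holderBound₁ (ha : 0 < a) (ha1 : a < 1) (f : Holder 1 a) :
    HolderBound₁ a f (deriv f) (2 * ‖f‖) := by
  have h := f.holderBound₁_iteratedDeriv ha ha1 (l := 0) one_pos
  rwa [zero_add, iteratedDeriv_zero, iteratedDeriv_one] at h

theorem holderBound (ha : 0 < a) (ha1 : a < 1) (f : Holder k a) : HolderBound a f (2 * ‖f‖) := by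
  have h := f.holderBound_iteratedDeriv ha ha1 (Nat.zero_le k)
  rwa [iteratedDeriv_zero] at h

end Holder

theorem supNorm_le {ι : Type} [Nonempty ι] {g : ι → ℝ} {C : ℝ} (h : ∀ i, |g i| ≤ C) :
    supNorm g ≤ C := ciSup_le h

namespace HolderBound₁

variable {a C : ℝ} {f f' : ℝ → ℝ}

theorem iteratedDeriv_one_eq (hf : HolderBound₁ a f f' C) : iteratedDeriv 1 f = f' := by
  rw [iteratedDeriv_one]
  exact funext fun x => (hf.hasDerivAt x).deriv

/-- The element of `C^{1,a}` given by a periodic function with `C^{1,a}` bounds. -/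
def toHolder (ha : 0 < a) (hf : HolderBound₁ a f f' C) (hp : Function.Periodic f (2 * π)) :
    Holder 1 a :=
  ⟨f, hp, by
    have : ((1 : ℕ) : WithTop ℕ∞) = 1 := rfl
    rw [this, contDiff_one_iff_deriv]
    refine ⟨fun x => (hf.hasDerivAt x).differentiableAt, ?_⟩
    rw [funext fun x => (hf.hasDerivAt x).deriv]
    exact hf.bound.continuous ha, C, by
    rw [hf.iteratedDeriv_one_eq]
    exact hf.bound.holder⟩

theorem norm_toHolder_le (ha : 0 < a) (hf : HolderBound₁ a f f' C)
    (hp : Function.Periodic f (2 * π)) : ‖hf.toHolder ha hp‖ ≤ 3 * C := by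
  have hC := hf.nonneg
  have h0 : iteratedDeriv 0 (hf.toHolder ha hp) = f := iteratedDeriv_zero
  have h1 : iteratedDeriv 1 (hf.toHolder ha hp) = f' := hf.iteratedDeriv_one_eq
  -- The norm has three terms, two suprema and a seminorm, each at most C.
  rw [Holder.norm_def, Finset.sum_range_succ, Finset.sum_range_one, h0, h1]
  have b0 := supNorm_le hf.bdd
  have b1 := supNorm_le hf.bound.bdd
  have b2 : supNorm (holderQuot a f') ≤ C := by
    refine supNorm_le fun p => ?_
    have h0 : (0 : ℝ) ≤ |p.1 - p.2| ^ a := Real.rpow_nonneg (abs_nonneg _) a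
    rw [holderQuot, abs_div, abs_of_nonneg h0]
    exact div_le_of_le_mul₀ h0 hC (hf.bound.holder _ _)
  linarith

end HolderBound₁

section operators

variable {a : ℝ}

/-- The derivative of order `l ≤ 2`, from `C^{3,a}` to `C^{1,a}`. -/
noncomputable def derivOp (ha : 0 < a) (ha1 : a < 1) (l : ℕ) (hl : l < 3) :
    Holder 3 a →L[ℝ] Holder 1 a :=
  LinearMap.mkContinuous
    { toFun := fun f => (f.holderBound₁_iteratedDeriv ha ha1 hl).toHolder ha
        (f.periodic_iteratedDeriv l)
      map_add' := fun f g => Subtype.ext (Holder.iteratedDeriv_add' f g hl.le)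
      map_smul' := fun c f => Subtype.ext (Holder.iteratedDeriv_smul' c f hl.le) }
    -- The 3 of `norm_toHolder_le` times the 2 of `holderBound₁_iteratedDeriv`.
    6 fun f => (HolderBound₁.norm_toHolder_le ha
      (f.holderBound₁_iteratedDeriv ha ha1 hl) (f.periodic_iteratedDeriv l)).trans (by linarith)

/-- The Hilbert transform on `C^{1,a}`. -/
noncomputable def hilbertOp (ha : 0 < a) (ha1 : a < 1) : Holder 1 a →L[ℝ] Holder 1 a :=
  LinearMap.mkContinuous
    { toFun := fun f => ((f.holderBound₁ ha ha1).hilbert ha ha1).toHolder ha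
        ((f.holderBound ha ha1).periodic_hilbert ha ha1 f.periodic)
      map_add' := fun f g => Subtype.ext ((f.holderBound ha ha1).hilbert_add ha ha1
        (g.holderBound ha ha1))
      map_smul' := fun c f => Subtype.ext ((f.holderBound ha ha1).hilbert_smul ha ha1 c) }
    (12 * HolderBound.hilbertConst a) fun f =>
      (HolderBound₁.norm_toHolder_le ha ((f.holderBound₁ ha ha1).hilbert ha ha1)
        ((f.holderBound ha ha1).periodic_hilbert ha ha1 f.periodic)).trans
        (by linarith)

/-- Multiplication on `C^{1,a}`. -/
noncomputable def mulOp (ha : 0 < a) (ha1 : a < 1) :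
    Holder 1 a →L[ℝ] Holder 1 a →L[ℝ] Holder 1 a :=
  LinearMap.mkContinuous₂
    (LinearMap.mk₂ ℝ (fun f g => ((f.holderBound₁ ha ha1).mul ha ha1
      (g.holderBound₁ ha ha1)).toHolder ha (f.periodic.mul g.periodic))
      (fun f f' g => Subtype.ext (add_mul f.1 f'.1 g.1))
      (fun c f g => Subtype.ext (smul_mul_assoc c f.1 g.1))
      (fun f g g' => Subtype.ext (mul_add f.1 g.1 g'.1))
      (fun c f g => Subtype.ext (mul_smul_comm c f.1 g.1)))
    -- 96 = 3 · 8 · 2 · 2: the 3 of `norm_toHolder_le`, the 8 of `HolderBound₁.mul` and a 2 for each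
    -- factor.
    96 fun f g => (HolderBound₁.norm_toHolder_le ha ((f.holderBound₁ ha ha1).mul ha ha1
      (g.holderBound₁ ha ha1)) (f.periodic.mul g.periodic)).trans (by linarith)

theorem Holder.deriv_add (f g : Holder 1 a) :
    deriv (f + g : Holder 1 a) = deriv f + deriv g := by
  rw [← iteratedDeriv_one, ← iteratedDeriv_one, ← iteratedDeriv_one]
  exact Holder.iteratedDeriv_add' f g le_rfl

theorem Holder.deriv_smul (c : ℝ) (f : Holder 1 a) :
    deriv (c • f : Holder 1 a) = c • deriv f := by
  rw [← iteratedDeriv_one, ← iteratedDeriv_one]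
  exact Holder.iteratedDeriv_smul' c f le_rfl

/-- All three derivatives of φ are needed: the derivative of the commutator contains `commIntegral`
of φ' and φ'', and its increments are controlled through φ'''. -/
theorem holderBound₁_commutator (ha : 0 < a) (ha1 : a < 1) (φ : Holder 3 a) (G : Holder 1 a) :
    HolderBound₁ a (commutator hilbert φ (deriv G))
      (commIntegral (iteratedDeriv 1 φ) (iteratedDeriv 2 φ) G +
        commIntegral (iteratedDeriv 0 φ) (iteratedDeriv 1 φ) (deriv G))
      (6 * (π ^ 3 / a) * (2 * ‖φ‖ * (2 * ‖G‖))) := by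
  have h := commutator_hilbert_eq ha ha1
    (φ.holderBound₁_iteratedDeriv ha ha1 (l := 0) (by norm_num)) (G.holderBound₁ ha ha1)
  rw [iteratedDeriv_zero] at h
  rw [h]
  exact holderBound₁_commIntegral ha ha1 (φ.hasDerivAt_iteratedDeriv (l := 0) (by norm_num))
    (φ.hasDerivAt_iteratedDeriv (by norm_num)) (φ.hasDerivAt_iteratedDeriv (by norm_num))
    (φ.holderBound_iteratedDeriv ha ha1 (by norm_num))
    (φ.holderBound_iteratedDeriv ha ha1 (by norm_num))
    (φ.holderBound_iteratedDeriv ha ha1 le_rfl) (G.holderBound₁ ha ha1)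

theorem periodic_commutator (ha : 0 < a) (ha1 : a < 1) {T A B : ℝ} {f g : ℝ → ℝ}
    (hf : HolderBound a f A) (hg : HolderBound a g B) (hfp : Function.Periodic f T)
    (hgp : Function.Periodic g T) : Function.Periodic (commutator hilbert f g) T :=
  ((hf.mul hg).periodic_hilbert ha ha1 (hfp.mul hgp)).sub
    (hfp.mul (hg.periodic_hilbert ha ha1 hgp))

theorem odd_commutator (ha : 0 < a) (ha1 : a < 1) {A B : ℝ} {f g : ℝ → ℝ}
    (hf : HolderBound a f A) (hg : HolderBound a g B) (hfe : Function.Even f)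
    (hge : Function.Even g) : Function.Odd (commutator hilbert f g) := by
  intro x
  have h1 := (hf.mul hg).odd_hilbert ha ha1 (hfe.mul_even hge) x
  have h2 := hg.odd_hilbert ha ha1 hge x
  simp only [commutator, Pi.sub_apply, Pi.mul_apply, h1, h2, hfe x]
  ring

theorem periodic_commutator_deriv (ha : 0 < a) (ha1 : a < 1) (φ : Holder 3 a) (G : Holder 1 a) :
    Function.Periodic (commutator hilbert φ (deriv G)) (2 * π) :=
  periodic_commutator ha ha1 (φ.holderBound ha ha1) (G.holderBound₁ ha ha1).bound φ.periodic
    (iteratedDeriv_one (f := G.1) ▸ G.periodic_iteratedDeriv 1)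

/-- The commutator of the Hilbert transform with `φ`, applied to the derivative of `G`. -/
noncomputable def commutatorOp (ha : 0 < a) (ha1 : a < 1) :
    Holder 3 a →L[ℝ] Holder 1 a →L[ℝ] Holder 1 a :=
  LinearMap.mkContinuous₂
    (LinearMap.mk₂ ℝ (fun φ G => (holderBound₁_commutator ha ha1 φ G).toHolder ha
        (periodic_commutator_deriv ha ha1 φ G))
      (fun φ ψ G => Subtype.ext <| by
        have hG := (G.holderBound₁ ha ha1).bound
        change commutator hilbert (φ.1 + ψ.1) (deriv G.1) =
          commutator hilbert φ.1 (deriv G.1) + commutator hilbert ψ.1 (deriv G.1)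
        simp only [commutator, add_mul]
        rw [((φ.holderBound ha ha1).mul hG).hilbert_add ha ha1 ((ψ.holderBound ha ha1).mul hG)]
        ring)
      (fun c φ G => Subtype.ext <| by
        have hG := (G.holderBound₁ ha ha1).bound
        change commutator hilbert (c • φ.1) (deriv G.1) = c • commutator hilbert φ.1 (deriv G.1)
        simp only [commutator, smul_mul_assoc, smul_sub]
        rw [((φ.holderBound ha ha1).mul hG).hilbert_smul ha ha1])
      (fun φ G E => Subtype.ext <| by
        have hG := (G.holderBound₁ ha ha1).bound
        have hE := (E.holderBound₁ ha ha1).bound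
        have hφ := φ.holderBound ha ha1
        change commutator hilbert φ.1 (deriv (G + E : Holder 1 a)) =
          commutator hilbert φ.1 (deriv G.1) + commutator hilbert φ.1 (deriv E.1)
        rw [Holder.deriv_add]
        simp only [commutator, mul_add]
        rw [(hφ.mul hG).hilbert_add ha ha1 (hφ.mul hE), hG.hilbert_add ha ha1 hE]
        ring)
      (fun c φ G => Subtype.ext <| by
        have hG := (G.holderBound₁ ha ha1).bound
        have hφ := φ.holderBound ha ha1
        change commutator hilbert φ.1 (deriv (c • G : Holder 1 a)) =
          c • commutator hilbert φ.1 (deriv G.1)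
        rw [Holder.deriv_smul]
        simp only [commutator, mul_smul_comm, smul_sub]
        rw [(hφ.mul hG).hilbert_smul ha ha1, hG.hilbert_smul ha ha1, mul_smul_comm]))
    (72 * (π ^ 3 / a)) fun φ G =>
      (HolderBound₁.norm_toHolder_le ha (holderBound₁_commutator ha ha1 φ G)
        (periodic_commutator_deriv ha ha1 φ G)).trans (le_of_eq (by ring))

/-! ### The linear and bilinear parts of `F` -/

variable (ha : 0 < a) (ha1 : a < 1)

/-- The linear part of `F` multiplied by the velocity. -/
noncomputable def velocityPart (α₀ : ℝ) : Holder 3 a →L[ℝ] Holder 1 a :=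
  (2 : ℝ) • derivOp ha ha1 1 (by norm_num) +
    α₀ • (hilbertOp ha ha1).comp (derivOp ha ha1 2 (by norm_num))

/-- The linear part of `F` that does not involve the velocity. -/
noncomputable def linearPart (α₀ β ε : ℝ) : Holder 3 a →L[ℝ] Holder 1 a :=
  ((α₀ - β) / ε) • (hilbertOp ha ha1).comp (derivOp ha ha1 2 (by norm_num)) +
    (1 / ε) • (derivOp ha ha1 1 (by norm_num) +
      (hilbertOp ha ha1).comp (derivOp ha ha1 0 (by norm_num)))

/-- The bilinear map whose restriction to the diagonal is the quadratic part of `F`. -/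
noncomputable def quadraticPart (α₀ β : ℝ) :
    Holder 3 a →L[ℝ] Holder 3 a →L[ℝ] Holder 1 a :=
  let H := hilbertOp ha ha1
  let D₀ := derivOp ha ha1 0 (by norm_num)
  let HD₁ := H.comp (derivOp ha ha1 1 (by norm_num))
  let HD₂ := H.comp (derivOp ha ha1 2 (by norm_num))
  (ContinuousLinearMap.compL ℝ _ _ _ H).comp ((mulOp ha ha1).bilinearComp HD₁ HD₁)
    -- H φ' is already of class C^{1,a}, so this commutator is bounded term by term. Only the last
    -- one needs the smoothing estimate, with G = H φ''.
    - ((ContinuousLinearMap.compL ℝ _ _ _ H).comp ((mulOp ha ha1).bilinearComp D₀ HD₁)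
      - (mulOp ha ha1).bilinearComp D₀ (H.comp HD₁))
    - (α₀ - β) • (commutatorOp ha ha1).bilinearComp (ContinuousLinearMap.id ℝ _) HD₂

theorem velocityPart_apply (α₀ : ℝ) (φ : Holder 3 a) (x : ℝ) :
    (velocityPart ha ha1 α₀ φ : ℝ → ℝ) x =
      2 * deriv φ x + α₀ * hilbert (iteratedDeriv 2 φ) x := by
  rw [← iteratedDeriv_one]
  rfl

theorem linearPart_apply (α₀ β ε : ℝ) (φ : Holder 3 a) (x : ℝ) :
    (linearPart ha ha1 α₀ β ε φ : ℝ → ℝ) x =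
      (α₀ - β) / ε * hilbert (iteratedDeriv 2 φ) x + 1 / ε * (deriv φ x + hilbert φ x) := by
  have e : hilbert φ x = hilbert (iteratedDeriv 0 φ) x := by rw [iteratedDeriv_zero]
  rw [← iteratedDeriv_one, e]
  rfl

/-- Presents H φ''' as the derivative of a C^{1,a} function, the form in which `commutatorOp`
accepts it. -/
theorem Holder.deriv_hilbert_iteratedDeriv_two (ha : 0 < a) (ha1 : a < 1) (φ : Holder 3 a) :
    deriv (hilbert (iteratedDeriv 2 φ)) = hilbert (iteratedDeriv 3 φ) :=
  funext fun x => (((φ.holderBound₁_iteratedDeriv ha ha1 (l := 2) (by norm_num)).hilbert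
    ha ha1).hasDerivAt x).deriv

theorem quadraticPart_apply (α₀ β : ℝ) (φ h : Holder 3 a) (x : ℝ) :
    (quadraticPart ha ha1 α₀ β φ h : ℝ → ℝ) x =
      hilbert (hilbert (deriv φ) * hilbert (deriv h)) x
        - commutator hilbert φ (hilbert (deriv h)) x
        - (α₀ - β) * commutator hilbert φ (hilbert (iteratedDeriv 3 h)) x := by
  have e : commutator hilbert φ (hilbert (deriv h)) =
      commutator hilbert (iteratedDeriv 0 φ) (hilbert (deriv h)) := by rw [iteratedDeriv_zero]
  rw [← Holder.deriv_hilbert_iteratedDeriv_two ha ha1, e, ← iteratedDeriv_one,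
    ← iteratedDeriv_one]
  rfl

/-! ### Parity -/

theorem odd_of_hasDerivAt_of_even {f f' : ℝ → ℝ} (hd : ∀ x, HasDerivAt f (f' x) x)
    (he : Function.Even f) : Function.Odd f' := by
  intro x
  have h := (hd (-x)).scomp x (hasDerivAt_neg x)
  have e : f ∘ (fun y => -y) = f := funext he
  change HasDerivAt (f ∘ fun y => -y) _ x at h
  rw [e] at h
  have := h.unique (hd x)
  simp only [smul_eq_mul] at this
  linarith

theorem even_of_hasDerivAt_of_odd {f f' : ℝ → ℝ} (hd : ∀ x, HasDerivAt f (f' x) x)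
    (ho : Function.Odd f) : Function.Even f' := by
  intro x
  have h := (hd (-x)).scomp x (hasDerivAt_neg x)
  have e : f ∘ (fun y => -y) = -f := funext ho
  change HasDerivAt (f ∘ fun y => -y) _ x at h
  rw [e] at h
  have := h.unique (hd x).neg
  simp only [smul_eq_mul] at this
  linarith

section parity

variable {φ : Holder 3 a}

theorem Holder.odd_deriv (hφ : Function.Even φ) : Function.Odd (deriv φ) := by
  have := φ.hasDerivAt_iteratedDeriv (l := 0) (by norm_num)
  rw [zero_add, iteratedDeriv_one, iteratedDeriv_zero] at this
  exact odd_of_hasDerivAt_of_even this hφ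

theorem Holder.even_iteratedDeriv_two (hφ : Function.Even φ) : Function.Even (iteratedDeriv 2 φ) := by
  have := φ.hasDerivAt_iteratedDeriv (l := 1) (by norm_num)
  rw [iteratedDeriv_one] at this
  exact even_of_hasDerivAt_of_odd this (Holder.odd_deriv hφ)

theorem Holder.odd_iteratedDeriv_three (hφ : Function.Even φ) : Function.Odd (iteratedDeriv 3 φ) :=
  odd_of_hasDerivAt_of_even (φ.hasDerivAt_iteratedDeriv (by norm_num))
    (Holder.even_iteratedDeriv_two hφ)

end parity

theorem Holder.holderBound_deriv (ha : 0 < a) (ha1 : a < 1) (φ : Holder 3 a) :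
    HolderBound a (deriv φ) (2 * ‖φ‖) := by
  rw [← iteratedDeriv_one]
  exact φ.holderBound_iteratedDeriv ha ha1 (by norm_num)

theorem odd_velocityPart (α₀ : ℝ) {φ : Holder 3 a} (hφ : Function.Even φ) :
    Function.Odd (velocityPart ha ha1 α₀ φ) := by
  intro x
  rw [velocityPart_apply, velocityPart_apply, Holder.odd_deriv hφ,
    (φ.holderBound_iteratedDeriv ha ha1 (by norm_num)).odd_hilbert ha ha1
      (Holder.even_iteratedDeriv_two hφ)]
  ring

theorem odd_linearPart (α₀ β ε : ℝ) {φ : Holder 3 a} (hφ : Function.Even φ) :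
    Function.Odd (linearPart ha ha1 α₀ β ε φ) := by
  intro x
  rw [linearPart_apply, linearPart_apply, Holder.odd_deriv hφ,
    (φ.holderBound_iteratedDeriv ha ha1 (by norm_num)).odd_hilbert ha ha1
      (Holder.even_iteratedDeriv_two hφ), (φ.holderBound ha ha1).odd_hilbert ha ha1 hφ]
  ring

theorem odd_quadraticPart (α₀ β : ℝ) {φ h : Holder 3 a} (hφ : Function.Even φ)
    (hh : Function.Even h) : Function.Odd (quadraticPart ha ha1 α₀ β φ h) := by
  intro x
  have hφ1 := (Holder.holderBound_deriv ha ha1 φ).hilbert ha ha1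
  have hh1 := (Holder.holderBound_deriv ha ha1 h).hilbert ha ha1
  have hh3 := (h.holderBound_iteratedDeriv ha ha1 le_rfl).hilbert ha ha1
  have eφ1 := (Holder.holderBound_deriv ha ha1 φ).even_hilbert ha ha1 (Holder.odd_deriv hφ)
  have eh1 := (Holder.holderBound_deriv ha ha1 h).even_hilbert ha ha1 (Holder.odd_deriv hh)
  have eh3 := (h.holderBound_iteratedDeriv ha ha1 le_rfl).even_hilbert ha ha1
    (Holder.odd_iteratedDeriv_three hh)
  rw [quadraticPart_apply, quadraticPart_apply,
    (hφ1.mul hh1).odd_hilbert ha ha1 (eφ1.mul_even eh1),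
    odd_commutator ha ha1 (φ.holderBound ha ha1) hh1 hφ eh1,
    odd_commutator ha ha1 (φ.holderBound ha ha1) hh3 hφ eh3]
  ring

theorem F_eq (α₀ β ε c : ℝ) (φ : Holder 3 a) :
    F α₀ β ε c φ = (c • velocityPart ha ha1 α₀ φ + linearPart ha ha1 α₀ β ε φ +
      quadraticPart ha ha1 α₀ β φ φ : Holder 1 a) := by
  funext x
  simp only [Holder.coe_add, Holder.coe_smul, Pi.add_apply, Pi.smul_apply, smul_eq_mul,
    velocityPart_apply, linearPart_apply, quadraticPart_apply, F, sq]
  ring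

/-- The polarization of the quadratic part. The product of H φ' and H h' is symmetric, hence the
factor 2 in `dF`; the commutators are not, hence two terms for each. -/
theorem dF_eq (α₀ β ε c : ℝ) (φ h : Holder 3 a) :
    dF α₀ β ε c φ h = (c • velocityPart ha ha1 α₀ h + linearPart ha ha1 α₀ β ε h +
      quadraticPart ha ha1 α₀ β φ h + quadraticPart ha ha1 α₀ β h φ : Holder 1 a) := by
  funext x
  simp only [Holder.coe_add, Holder.coe_smul, Pi.add_apply, Pi.smul_apply, smul_eq_mul,
    velocityPart_apply, linearPart_apply, quadraticPart_apply, dF,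
    mul_comm (hilbert (deriv h)) (hilbert (deriv φ))]
  ring

/-! ### Restriction to the cosine and sine spaces -/

theorem even_of_X (φ : X a) : Function.Even φ := by
  intro x
  obtain ⟨u, hu⟩ := φ.2
  have h1 := hu (-x)
  simp only [mul_neg, Real.cos_neg] at h1
  exact h1.unique (hu x)

theorem mem_Y_of_odd (ha : 0 < a) (ha1 : a < 1) {f : Holder 1 a} (ho : Function.Odd f) : f ∈ Y a :=
  exists_hasSum_sin_of_odd ho f.periodic (f.holderBound₁ ha ha1).hasDerivAt
    ((f.holderBound₁ ha ha1).bound.continuous ha)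

/-- The restriction of `velocityPart` to a map from `X` to `Y`. -/
noncomputable def velocityPartXY (α₀ : ℝ) : X a →L[ℝ] Y a :=
  ((velocityPart ha ha1 α₀).comp (X a).subtypeL).codRestrict (Y a)
    fun φ => mem_Y_of_odd ha ha1 (odd_velocityPart ha ha1 α₀ (even_of_X φ))

/-- The restriction of `linearPart` to a map from `X` to `Y`. -/
noncomputable def linearPartXY (α₀ β ε : ℝ) : X a →L[ℝ] Y a :=
  ((linearPart ha ha1 α₀ β ε).comp (X a).subtypeL).codRestrict (Y a)
    fun φ => mem_Y_of_odd ha ha1 (odd_linearPart ha ha1 α₀ β ε (even_of_X φ))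

/-- The restriction of `quadraticPart` to a bilinear map from `X` to `Y`. -/
noncomputable def quadraticPartXY (α₀ β : ℝ) : X a →L[ℝ] X a →L[ℝ] Y a :=
  LinearMap.mkContinuous₂
    (LinearMap.mk₂ ℝ (fun φ h => ⟨quadraticPart ha ha1 α₀ β φ.1 h.1,
        mem_Y_of_odd ha ha1 (odd_quadraticPart ha ha1 α₀ β (even_of_X φ) (even_of_X h))⟩)
      (fun φ ψ h => Subtype.ext (by simp))
      (fun c φ h => Subtype.ext (by simp))
      (fun φ h k => Subtype.ext (by simp))
      (fun c φ h => Subtype.ext (by simp)))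
    ‖quadraticPart ha ha1 α₀ β‖ fun φ h => (quadraticPart ha ha1 α₀ β).le_opNorm₂ φ.1 h.1

end operators

end OddWaves


theorem proposition3p1 (α α₀ β ε : ℝ) (hα0 : 0 < α) (hα1 : α < 1) (hα₀ : 0 < α₀) (hε : 0 < ε) :
    -- every principal value in `F[c, φ]` (the case `h = φ`) and in `∂_φ F[c, φ] h` exists,
    -- for all `φ, h` of class `C^{3,α}`
    (∀ φ h : OddWaves.Holder 3 α,
      (∀ j ≤ 3, OddWaves.HilbertExists (iteratedDeriv j φ)) ∧
      OddWaves.HilbertExists (OddWaves.hilbert (deriv φ) * OddWaves.hilbert (deriv h)) ∧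
      OddWaves.HilbertExists (φ * OddWaves.hilbert (deriv h)) ∧
      OddWaves.HilbertExists (OddWaves.hilbert (deriv h)) ∧
      OddWaves.HilbertExists (φ * OddWaves.hilbert (iteratedDeriv 3 h)) ∧
      OddWaves.HilbertExists (OddWaves.hilbert (iteratedDeriv 3 h))) ∧
    -- even functions are mapped to odd functions
    (∀ (c : ℝ) (φ : OddWaves.Holder 3 α), Function.Even φ →
      Function.Odd (OddWaves.F α₀ β ε c φ)) ∧
    -- `F` is a `C¹` map from `ℝ × X` to `Y`
    ∃ G : ℝ × OddWaves.X α → OddWaves.Y α,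
      (∀ (c : ℝ) (φ : OddWaves.X α), (G (c, φ) : ℝ → ℝ) = OddWaves.F α₀ β ε c φ) ∧
      ContDiff ℝ 1 G ∧
      -- its Gateaux derivative in `φ` is given by `dF` and is Lipschitz in `φ`
      ∃ D : ℝ → OddWaves.X α → OddWaves.X α →L[ℝ] OddWaves.Y α,
        (∀ (c : ℝ) (φ h : OddWaves.X α),
          (D c φ h : ℝ → ℝ) = OddWaves.dF α₀ β ε c φ h ∧
          HasLineDerivAt ℝ (fun ψ : OddWaves.X α => G (c, ψ)) (D c φ h) φ h) ∧
        ∃ C : ℝ, ∀ (c : ℝ) (φ₁ φ₂ h : OddWaves.X α),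
          ‖D c φ₁ h - D c φ₂ h‖ ≤ C * ‖h‖ * ‖φ₁ - φ₂‖ := by
  refine ⟨fun φ h => ?_, fun c φ hφ => ?_, ?_⟩
  · have hφ := φ.holderBound hα0 hα1
    have hφ1 := (OddWaves.Holder.holderBound_deriv hα0 hα1 φ).hilbert hα0 hα1
    have hh1 := (OddWaves.Holder.holderBound_deriv hα0 hα1 h).hilbert hα0 hα1
    have hh3 := (h.holderBound_iteratedDeriv hα0 hα1 le_rfl).hilbert hα0 hα1
    exact ⟨fun j hj => (φ.holderBound_iteratedDeriv hα0 hα1 hj).hilbertExists hα0 hα1,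
      (hφ1.mul hh1).hilbertExists hα0 hα1, (hφ.mul hh1).hilbertExists hα0 hα1,
      hh1.hilbertExists hα0 hα1, (hφ.mul hh3).hilbertExists hα0 hα1,
      hh3.hilbertExists hα0 hα1⟩
  · intro x
    have h1 := OddWaves.odd_velocityPart hα0 hα1 α₀ hφ x
    have h2 := OddWaves.odd_linearPart hα0 hα1 α₀ β ε hφ x
    have h3 := OddWaves.odd_quadraticPart hα0 hα1 α₀ β hφ hφ x
    rw [OddWaves.F_eq hα0 hα1]
    simp only [OddWaves.Holder.coe_add, OddWaves.Holder.coe_smul, Pi.add_apply, Pi.smul_apply,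
      smul_eq_mul, h1, h2, h3]
    ring
  · set V := OddWaves.velocityPartXY hα0 hα1 α₀
    set L := OddWaves.linearPartXY hα0 hα1 α₀ β ε
    set Q := OddWaves.quadraticPartXY hα0 hα1 α₀ β
    set K := ‖OddWaves.quadraticPart hα0 hα1 α₀ β‖
    have hK : ∀ φ h, ‖Q φ h‖ ≤ K * ‖φ‖ * ‖h‖ := fun φ h =>
      (OddWaves.quadraticPart hα0 hα1 α₀ β).le_opNorm₂ φ.1 h.1
    refine ⟨fun p => p.1 • V p.2 + L p.2 + Q p.2 p.2,
      fun c φ => (OddWaves.F_eq hα0 hα1 α₀ β ε c φ.1).symm, by fun_prop,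
      fun c φ => c • V + L + Q φ + Q.flip φ, fun c φ h =>
        ⟨(OddWaves.dF_eq hα0 hα1 α₀ β ε c φ.1 h.1).symm, ?_⟩, 2 * K, fun c φ₁ φ₂ h => ?_⟩
    · have hd : HasFDerivAt (fun ψ => c • V ψ + L ψ + Q ψ ψ) (c • V + L + Q φ + Q.flip φ) φ := by
        refine (((V.hasFDerivAt (x := φ)).const_smul c).add L.hasFDerivAt).add
          ((Q.hasFDerivAt (x := φ)).clm_apply (hasFDerivAt_id φ)) |>.congr_fderiv ?_
        ext1 h
        simp [add_assoc]
      exact hd.hasLineDerivAt h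
    -- The linear parts, and `c` with them, cancel; the two remaining values of Q cost K each.
    · have e : (c • V + L + Q φ₁ + Q.flip φ₁) h - (c • V + L + Q φ₂ + Q.flip φ₂) h =
          Q (φ₁ - φ₂) h + Q h (φ₁ - φ₂) := by
        simp only [add_apply, smul_apply, ContinuousLinearMap.flip_apply, map_sub, sub_apply]
        abel
      rw [e]
      refine (norm_add_le _ _).trans ?_
      have h1 := hK (φ₁ - φ₂) h
      have h2 := hK h (φ₁ - φ₂)
      linarith
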